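/- Fix an even number $M\ge 2$ and let $\mathbb P=\{0,1,\dots,M\}$ be the set of priorities. **Open parity games.** An open parity game (oPG) $\mathcal A\colon(m_r,m_l)\to(n_r,n_l)$ consists of a finite set $V=V_\exists\uplus V_\forall$ of nodes, a set $E\subseteq V\times V$ of edges such that every node has a successor, a labelling $\Omega\colon E\to\mathbb P$, and pairwise disjoint, totally ordered sets of open ends $I_r,I_l,O_r,O_l\subseteq V_\exists$ with $|I_r|=m_r$, $|O_l|=m_l$, $|O_r|=n_r$, $|I_l|=n_l$. Elements of $I=I_r\cup I_l$ are entrances and elements of $O=O_r\cup O_l$ are exits. The only edge leaving an exit $o$ is a self-loop $(o,o)$, and $\Omega(o,o)=0$. The $k$-th elements of these ordered sets are written $i_{r,k},i_{l,k},o_{r,k},o_{l,k}$. **Strategies and denotations.** An $\exists$-strategy (a $\forall$-strategy) is a function $V^*V_\exists\to V$ (resp. $V^*V_\forall\to V$) that chooses, after each finite path ending in $V_\exists$ (resp. $V_\forall$), an outgoing edge of the last node. Strategies $\sigma$ of $\exists$ and $\tau$ of $\forall$ and a node $v$ induce an infinite play $\pi^{\sigma,\tau}_v$ from $v$. The denotation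 $[\![p]\!]$ of a play $p$ is $(o,m)$ if $p$ reaches the exit $o$, where $m$ is the maximum of the priorities on $p$ until $o$ is reached; otherwise it is $\top$ if the largest priority that occurs infinitely often on $p$ is even, and $\bot$ if it is odd. Denotations lie in $D=\{\bot,\top\}\cup(O\times\mathbb P)$. **Pareto fronts.** Order $\mathbb P$ totally by $M-1\prec M-3\prec\dots\prec 1\prec 0\prec 2\prec\dots\prec M$, and order $D$ partially by letting $\bot$ be the least element, $\top$ the greatest element, and $(o,m)\preceq(o',m')$ iff $o=o'$ and $m\preceq m'$. For $T\subseteq D$ let $\min T$ be the set of minimal elements of $T$. For $T_1,T_2\subseteq D$ put $T_1\preceq_{\mathbf U}T_2$ iff for every $d_2\in T_2$ there is $d_1\in T_1$ with $d_1\preceq d_2$; for a set $S$ of subsets of $D$ let $\max S$ be the set of $\preceq_{\mathbf U}$-maximal elements of $S$. The Pareto front of $\mathcal A$ at an entrance $i$ is $$\mathrm{PF}(\mathcal A,i)=\max\Big\{\min\big\{[\![\pi^{\sigma,\tau}_i]\!]\;\big|\;\tau\text{ a }\forall\text{-strategy}\big\}\;\Big|\;\sigma\text{ an }\exists\text{-strategy}\Big\}.$$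 **Sum.** For $\mathcal A\colon(m_r,m_l)\to(n_r,n_l)$ and $\mathcal B\colon(k_r,k_l)\to(l_r,l_l)$, the sum $\mathcal A\oplus\mathcal B\colon(m_r+k_r,m_l+k_l)\to(n_r+l_r,n_l+l_l)$ is their disjoint union, where in each of the four ordered sets of open ends those of $\mathcal A$ precede those of $\mathcal B$. **Sequential composition.** For $\mathcal A\colon(m_r,m_l)\to(l_r,l_l)$ and $\mathcal B\colon(l_r,l_l)\to(n_r,n_l)$, the sequential composition $\mathcal A;\mathcal B\colon(m_r,m_l)\to(n_r,n_l)$ is the disjoint union of $\mathcal A$ and $\mathcal B$ in which the self-loops at the exits in $O_r^{\mathcal A}$ and $O_l^{\mathcal B}$ are replaced by edges $(o^{\mathcal A}_{r,k},i^{\mathcal B}_{r,k})$ for $1\le k\le l_r$ and $(o^{\mathcal B}_{l,k},i^{\mathcal A}_{l,k})$ for $1\le k\le l_l$, all of priority $0$. Its open ends are $I_r^{\mathcal A}$, $I_l^{\mathcal B}$, $O_r^{\mathcal B}$, $O_l^{\mathcal A}$. **Shortcut.** The shortcut $\mathrm{sc}(\mathcal A)$ is the oPG with the same open ends as $\mathcal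 A$, all owned by $\exists$, and one further node $(i,\mathbf r)$, owned by $\forall$, for each entrance $i$ and each $\mathbf r\in\mathrm{PF}(\mathcal A,i)$. Its edges are: a self-loop of priority $0$ at each exit; an edge of priority $0$ from $i$ to $(i,\mathbf r)$; an edge of priority $m$ from $(i,\mathbf r)$ to $o$ for each $(o,m)\in\mathbf r$; a self-loop of priority $0$ at $(i,\mathbf r)$ if $\top\in\mathbf r$; and a self-loop of priority $1$ at $(i,\mathbf r)$ if $\bot\in\mathbf r$. **Proposition.** Let $\ast\in\{\,;\,,\oplus\}$, let $\mathcal A,\mathcal B$ be oPGs for which $\mathcal A\ast\mathcal B$ is defined, and let $i$ be an entrance of $\mathcal A\ast\mathcal B$. Under the identification of the open ends of $\mathcal A\ast\mathcal B$ with those of $\mathrm{sc}(\mathcal A)\ast\mathrm{sc}(\mathcal B)$, $$\mathrm{PF}(\mathcal A\ast\mathcal B,\,i)=\mathrm{PF}(\mathrm{sc}(\mathcal A)\ast\mathrm{sc}(\mathcal B),\,i).$$ -/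

import Mathlib

universe u v

/-! Priorities are `0, 1, …, M`, represented by `Fin (M + 1)`. -/

/-- Key of the sub-priority order: `m` is below `m'` iff `subKey m ≤ subKey m'`, i.e.
`… < 3 < 1 < 0 < 2 < 4 < …`. -/
def subKey {M : ℕ} (m : Fin (M + 1)) : ℤ :=
  if Even m.val then (m.val : ℤ) else -(m.val : ℤ)

theorem subKey_injective {M : ℕ} : Function.Injective (subKey (M := M)) := by
  intro a b h
  unfold subKey at h
  apply Fin.ext
  split_ifs at h with h1 h2 h2
  · omega
  · have : a.val = b.val := by omega
    rw [this] at h1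
    exact absurd h1 h2
  · have : a.val = b.val := by omega
    rw [this] at h1
    exact absurd h2 h1
  · omega

/-- The domain over a set `O` of exits: losing (`⊥`), winning (`⊤`), or reaching the exit `o`
with maximal priority `m`. -/
inductive Dom (M : ℕ) (O : Type) : Type
  | lose : Dom M O
  | win : Dom M O
  | out (o : O) (m : Fin (M + 1)) : Dom M O

namespace Dom

variable {M : ℕ} {O : Type}

/-- The domain order. -/
inductive Le : Dom M O → Dom M O → Prop
  | lose_le (d : Dom M O) : Le lose d
  | le_win (d : Dom M O) : Le d win
  | out_le_out (o : O) (m m' : Fin (M + 1)) (h : subKey m ≤ subKey m') : Le (out o m) (out o m')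

instance : PartialOrder (Dom M O) where
  le := Le
  le_refl d := by
    cases d with
    | lose => exact .lose_le _
    | win => exact .le_win _
    | out o m => exact .out_le_out _ _ _ le_rfl
  le_trans a b c hab hbc := by
    cases hab with
    | lose_le => exact .lose_le _
    | le_win =>
      cases hbc with
      | le_win => exact .le_win _
    | out_le_out o m m' h =>
      cases hbc with
      | le_win => exact .le_win _
      | out_le_out _ _ m'' h' => exact .out_le_out _ _ _ (h.trans h')
  le_antisymm a b hab hba := by
    cases hab with
    | lose_le => cases hba with
      | lose_le => rfl
    | le_win => cases hba with
      | le_win => rfl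
    | out_le_out o m m' h => cases hba with
      | out_le_out _ _ _ h' => rw [subKey_injective (le_antisymm h h')]

/-- The domain is finite when there are finitely many exits. -/
instance [Finite O] : Finite (Dom M O) := by
  let f : Dom M O → Bool ⊕ (O × Fin (M + 1)) := fun d => match d with
    | lose => .inl false
    | win => .inl true
    | out o m => .inr (o, m)
  refine Finite.of_injective f ?_
  intro a b h
  cases a <;> cases b <;> simp_all [f]

/-- The minimal elements of a subset of the domain. -/
def worst (T : Set (Dom M O)) : Set (Dom M O) := {d | Minimal (· ∈ T) d}

/-- The upper preorder on subsets of the domain. -/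
def UpperLe (T₁ T₂ : Set (Dom M O)) : Prop := ∀ d₂ ∈ T₂, ∃ d₁ ∈ T₁, d₁ ≤ d₂

/-- The elements of `S` that are maximal with respect to the upper preorder. -/
def best (S : Set (Set (Dom M O))) : Set (Set (Dom M O)) :=
  {T | T ∈ S ∧ ∀ T' ∈ S, UpperLe T T' → UpperLe T' T}

theorem worst_nonempty [Finite O] {T : Set (Dom M O)} (h : T.Nonempty) : (worst T).Nonempty := by
  obtain ⟨d, hd⟩ := (Set.toFinite T).exists_minimal h
  exact ⟨d, hd⟩

theorem best_nonempty [Finite O] {S : Set (Set (Dom M O))} (h : S.Nonempty) :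
    (best S).Nonempty := by
  let P : Preorder (Set (Dom M O)) :=
    { le := UpperLe
      lt := fun T₁ T₂ => UpperLe T₁ T₂ ∧ ¬ UpperLe T₂ T₁
      lt_iff_le_not_ge := fun _ _ => Iff.rfl
      le_refl := fun T d hd => ⟨d, hd, le_rfl⟩
      le_trans := fun T₁ T₂ T₃ h₁ h₂ d hd => by
        obtain ⟨e, he, hed⟩ := h₂ d hd
        obtain ⟨f, hf, hfe⟩ := h₁ e he
        exact ⟨f, hf, hfe.trans hed⟩ }
  obtain ⟨T, hT, hmax⟩ := @Set.Finite.exists_maximal _ P.toLE inferInstance S (Set.toFinite S) h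
  exact ⟨T, hT, fun T' hT' hle => hmax hT' hle⟩

end Dom

/-- An open parity game `(mr, ml) → (nr, nl)` with priorities `0, …, M`.  On its left boundary it
has `mr` rightward entrances and `ml` leftward exits, on its right boundary `nr` rightward exits
and `nl` leftward entrances.  The totally ordered sets of open ends are given as enumerations:
`entr (inl _)` are the rightward and `entr (inr _)` the leftward entrances, `exi (inl _)` the
rightward and `exi (inr _)` the leftward exits.  Player `∃` owns `VE`, player `∀` its complement.
The values of `prio` outside of the edge relation `E` are irrelevant. -/
structure OPG (M mr ml nr nl : ℕ) where
  V : Type u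
  finite_V : Finite V
  VE : Set V
  E : V → V → Prop
  prio : V → V → Fin (M + 1)
  exists_succ : ∀ x, ∃ y, E x y
  entr : Fin mr ⊕ Fin nl → V
  exi : Fin nr ⊕ Fin ml → V
  /-- The open ends are pairwise distinct. -/
  ends_injective : Function.Injective (Sum.elim entr exi)
  entr_mem : ∀ i, entr i ∈ VE
  exi_mem : ∀ o, exi o ∈ VE
  exi_sink : ∀ o x, E (exi o) x → x = exi o
  exi_prio : ∀ o, prio (exi o) (exi o) = 0

namespace OPG

variable {M mr ml nr nl : ℕ}

/-- A strategy of the player who owns the nodes in `S`, i.e. a function from `V* · S` to `V` that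
chooses an edge after every finite path ending in `S`. -/
structure Strategy (A : OPG.{u} M mr ml nr nl) (S : Set A.V) where
  move : List A.V → S → A.V
  valid : ∀ (h : List A.V) (x : S), List.IsChain A.E (h ++ [x.1]) → A.E x (move h x)

/-- `∃`-strategies. -/
abbrev EStrategy (A : OPG.{u} M mr ml nr nl) := Strategy A A.VE

/-- `∀`-strategies. -/
abbrev AStrategy (A : OPG.{u} M mr ml nr nl) := Strategy A A.VEᶜ

theorem strategy_nonempty (A : OPG.{u} M mr ml nr nl) (S : Set A.V) : Nonempty (Strategy A S) :=
  ⟨⟨fun _ x => (A.exists_succ x).choose, fun _ x _ => (A.exists_succ x).choose_spec⟩⟩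

open Classical in
/-- After `n` steps from `x` under `σ` and `τ`: the list of nodes visited before the current one,
in order, and the current node. -/
noncomputable def run (A : OPG.{u} M mr ml nr nl) (σ : A.EStrategy) (τ : A.AStrategy) (x : A.V) :
    ℕ → List A.V × A.V
  | 0 => ([], x)
  | n + 1 =>
    let s := run A σ τ x n
    (s.1 ++ [s.2], if h : s.2 ∈ A.VE then σ.move s.1 ⟨s.2, h⟩ else τ.move s.1 ⟨s.2, h⟩)

/-- The play from `x` induced by `σ` and `τ`. -/
noncomputable def play (A : OPG.{u} M mr ml nr nl) (σ : A.EStrategy) (τ : A.AStrategy) (x : A.V)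
    (n : ℕ) : A.V :=
  (A.run σ τ x n).2

/-- The parity condition: the largest priority that occurs infinitely often is even. -/
def ParityCondition (A : OPG.{u} M mr ml nr nl) (p : ℕ → A.V) : Prop :=
  ∃ m : Fin (M + 1), Even m.val ∧
    (∃ᶠ n in Filter.atTop, A.prio (p n) (p (n + 1)) = m) ∧
    ∀ m', (∃ᶠ n in Filter.atTop, A.prio (p n) (p (n + 1)) = m') → m' ≤ m

open Classical in
/-- The denotation of a play. If the play reaches an exit, then it is that exit, together with the
largest priority seen until the exit is reached. -/
noncomputable def den (A : OPG.{u} M mr ml nr nl) (p : ℕ → A.V) : Dom M (Fin nr ⊕ Fin ml) :=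
  if h : ∃ j, ∃ o, p j = A.exi o then
    Dom.out (Nat.find_spec h).choose
      ((Finset.range (Nat.find h)).sup fun k => A.prio (p k) (p (k + 1)))
  else if A.ParityCondition p then Dom.win else Dom.lose

/-- The minimal denotations against the `∃`-strategy `σ` from the entrance `i`. -/
noncomputable def outcome (A : OPG.{u} M mr ml nr nl) (i : Fin mr ⊕ Fin nl) (σ : A.EStrategy) :
    Set (Dom M (Fin nr ⊕ Fin ml)) :=
  Dom.worst {d | ∃ τ : A.AStrategy, A.den (A.play σ τ (A.entr i)) = d}

/-- The Pareto front at the entrance `i`. -/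
noncomputable def paretoFront (A : OPG.{u} M mr ml nr nl) (i : Fin mr ⊕ Fin nl) :
    Set (Set (Dom M (Fin nr ⊕ Fin ml))) :=
  Dom.best {T | ∃ σ : A.EStrategy, A.outcome i σ = T}

theorem outcome_nonempty (A : OPG.{u} M mr ml nr nl) (i : Fin mr ⊕ Fin nl) (σ : A.EStrategy) :
    (A.outcome i σ).Nonempty := by
  obtain ⟨τ⟩ := A.strategy_nonempty A.VEᶜ
  exact Dom.worst_nonempty ⟨_, τ, rfl⟩

theorem paretoFront_nonempty (A : OPG.{u} M mr ml nr nl) (i : Fin mr ⊕ Fin nl) :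
    (A.paretoFront i).Nonempty := by
  obtain ⟨σ⟩ := A.strategy_nonempty A.VE
  exact Dom.best_nonempty ⟨_, σ, rfl⟩

theorem nonempty_of_mem_paretoFront (A : OPG.{u} M mr ml nr nl) {i : Fin mr ⊕ Fin nl}
    {r : Set (Dom M (Fin nr ⊕ Fin ml))} (hr : r ∈ A.paretoFront i) : r.Nonempty := by
  obtain ⟨⟨σ, rfl⟩, -⟩ := hr
  exact A.outcome_nonempty i σ

/-- A result in a Pareto front contains at most one priority for each exit. -/
theorem out_unique (A : OPG.{u} M mr ml nr nl) {i : Fin mr ⊕ Fin nl}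
    {r : Set (Dom M (Fin nr ⊕ Fin ml))} (hr : r ∈ A.paretoFront i) {o : Fin nr ⊕ Fin ml}
    {m m' : Fin (M + 1)} (h : Dom.out o m ∈ r) (h' : Dom.out o m' ∈ r) : m = m' := by
  obtain ⟨⟨σ, rfl⟩, -⟩ := hr
  rcases le_total (subKey m) (subKey m') with hle | hle
  · have h1 : (Dom.out o m : Dom M (Fin nr ⊕ Fin ml)) ≤ Dom.out o m' := .out_le_out _ _ _ hle
    have h2 := le_antisymm h1 (h'.2 h.1 h1)
    injection h2
  · have h1 : (Dom.out o m' : Dom M (Fin nr ⊕ Fin ml)) ≤ Dom.out o m := .out_le_out _ _ _ hle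
    have h2 := le_antisymm h1 (h.2 h'.1 h1)
    injection h2 with _ h3
    exact h3.symm

/-! ### Sequential composition -/

section seq

variable {lr ll : ℕ}

/-- Edges of the sequential composition: those of the components, except that the self-loops at
the connected exits are replaced by edges to the corresponding entrances. -/
def seqE (A : OPG.{u} M mr ml lr ll) (B : OPG.{v} M lr ll nr nl) : A.V ⊕ B.V → A.V ⊕ B.V → Prop
  | .inl x, .inl y => A.E x y ∧ ∀ k : Fin lr, x ≠ A.exi (.inl k)
  | .inr x, .inr y => B.E x y ∧ ∀ k : Fin ll, x ≠ B.exi (.inr k)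
  | .inl x, .inr y => ∃ k : Fin lr, x = A.exi (.inl k) ∧ y = B.entr (.inl k)
  | .inr x, .inl y => ∃ k : Fin ll, x = B.exi (.inr k) ∧ y = A.entr (.inr k)

/-- The sequential composition. -/
def seq (A : OPG.{u} M mr ml lr ll) (B : OPG.{v} M lr ll nr nl) :
    OPG.{max u v} M mr ml nr nl where
  V := A.V ⊕ B.V
  finite_V := by
    have := A.finite_V
    have := B.finite_V
    infer_instance
  VE := {x | Sum.elim (· ∈ A.VE) (· ∈ B.VE) x}
  E := seqE A B
  prio
    | .inl x, .inl y => A.prio x y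
    | .inr x, .inr y => B.prio x y
    | _, _ => 0
  exists_succ := by
    rintro (x | x)
    · by_cases h : ∃ k : Fin lr, x = A.exi (.inl k)
      · obtain ⟨k, hk⟩ := h
        exact ⟨.inr (B.entr (.inl k)), k, hk, rfl⟩
      · obtain ⟨y, hy⟩ := A.exists_succ x
        exact ⟨.inl y, hy, fun k hk => h ⟨k, hk⟩⟩
    · by_cases h : ∃ k : Fin ll, x = B.exi (.inr k)
      · obtain ⟨k, hk⟩ := h
        exact ⟨.inl (A.entr (.inr k)), k, hk, rfl⟩
      · obtain ⟨y, hy⟩ := B.exists_succ x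
        exact ⟨.inr y, hy, fun k hk => h ⟨k, hk⟩⟩
  entr
    | .inl k => .inl (A.entr (.inl k))
    | .inr k => .inr (B.entr (.inr k))
  exi
    | .inl k => .inr (B.exi (.inl k))
    | .inr k => .inl (A.exi (.inr k))
  ends_injective := by
    have hA := A.ends_injective
    have hB := B.ends_injective
    rintro ((a | a) | (a | a)) ((b | b) | (b | b)) h <;>
      simp only [Sum.elim_inl, Sum.elim_inr, Sum.inl.injEq, Sum.inr.injEq, reduceCtorEq] at h
    · simpa using @hA (.inl (.inl a)) (.inl (.inl b)) h
    · simpa using @hA (.inl (.inl a)) (.inr (.inr b)) h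
    · simpa using @hB (.inl (.inr a)) (.inl (.inr b)) h
    · simpa using @hB (.inl (.inr a)) (.inr (.inl b)) h
    · simpa using @hB (.inr (.inl a)) (.inl (.inr b)) h
    · simpa using @hB (.inr (.inl a)) (.inr (.inl b)) h
    · simpa using @hA (.inr (.inr a)) (.inl (.inl b)) h
    · simpa using @hA (.inr (.inr a)) (.inr (.inr b)) h
  entr_mem := by
    rintro (k | k)
    · exact A.entr_mem _
    · exact B.entr_mem _
  exi_mem := by
    rintro (k | k)
    · exact B.exi_mem _
    · exact A.exi_mem _
  exi_sink := by
    rintro (k | k) (y | y) h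
    · obtain ⟨j, hj, -⟩ := h
      simpa using @B.ends_injective (.inr (.inl k)) (.inr (.inr j)) hj
    · exact congrArg Sum.inr (B.exi_sink _ _ h.1)
    · exact congrArg Sum.inl (A.exi_sink _ _ h.1)
    · obtain ⟨j, hj, -⟩ := h
      simpa using @A.ends_injective (.inr (.inr k)) (.inr (.inl j)) hj
  exi_prio := by
    rintro (k | k)
    · exact B.exi_prio _
    · exact A.exi_prio _

end seq

/-! ### Sum -/

section sum

variable {kr kl lr ll : ℕ}

/-- The sum. In each ordered set of open ends, those of `A` precede those of `B`. -/
def sum (A : OPG.{u} M mr ml nr nl) (B : OPG.{v} M kr kl lr ll) :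
    OPG.{max u v} M (mr + kr) (ml + kl) (nr + lr) (nl + ll) where
  V := A.V ⊕ B.V
  finite_V := by
    have := A.finite_V
    have := B.finite_V
    infer_instance
  VE := {x | Sum.elim (· ∈ A.VE) (· ∈ B.VE) x}
  E
    | .inl x, .inl y => A.E x y
    | .inr x, .inr y => B.E x y
    | _, _ => False
  prio
    | .inl x, .inl y => A.prio x y
    | .inr x, .inr y => B.prio x y
    | _, _ => 0
  exists_succ := by
    rintro (x | x)
    · obtain ⟨y, hy⟩ := A.exists_succ x
      exact ⟨.inl y, hy⟩
    · obtain ⟨y, hy⟩ := B.exists_succ x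
      exact ⟨.inr y, hy⟩
  entr
    | .inl k => Fin.addCases (fun a => .inl (A.entr (.inl a))) (fun b => .inr (B.entr (.inl b))) k
    | .inr k => Fin.addCases (fun a => .inl (A.entr (.inr a))) (fun b => .inr (B.entr (.inr b))) k
  exi
    | .inl k => Fin.addCases (fun a => .inl (A.exi (.inl a))) (fun b => .inr (B.exi (.inl b))) k
    | .inr k => Fin.addCases (fun a => .inl (A.exi (.inr a))) (fun b => .inr (B.exi (.inr b))) k
  ends_injective := by
    have hA := fun a b => A.ends_injective.eq_iff (a := a) (b := b)
    have hB := fun a b => B.ends_injective.eq_iff (a := a) (b := b)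
    rintro ((a | a) | (a | a)) ((b | b) | (b | b)) h <;>
      induction a using Fin.addCases <;> induction b using Fin.addCases <;>
      simp only [Sum.elim_inl, Sum.elim_inr, Fin.addCases_left, Fin.addCases_right,
        Sum.inl.injEq, Sum.inr.injEq, reduceCtorEq] at h <;>
      first
        | simpa using (hA (.inl _) (.inl _)).1 h
        | simpa using (hA (.inl _) (.inr _)).1 h
        | simpa using (hA (.inr _) (.inl _)).1 h
        | simpa using (hA (.inr _) (.inr _)).1 h
        | simpa using (hB (.inl _) (.inl _)).1 h
        | simpa using (hB (.inl _) (.inr _)).1 h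
        | simpa using (hB (.inr _) (.inl _)).1 h
        | simpa using (hB (.inr _) (.inr _)).1 h
  entr_mem := by
    rintro (k | k) <;> induction k using Fin.addCases <;> simp [A.entr_mem, B.entr_mem]
  exi_mem := by
    rintro (k | k) <;> induction k using Fin.addCases <;> simp [A.exi_mem, B.exi_mem]
  exi_sink := by
    rintro (k | k) (y | y) <;> induction k using Fin.addCases <;> simp <;>
      first
        | exact A.exi_sink _ _
        | exact B.exi_sink _ _
  exi_prio := by
    rintro (k | k) <;> induction k using Fin.addCases <;> simp [A.exi_prio, B.exi_prio]

end sum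

/-! ### The shortcut open parity game -/

section shortcut

/-- Nodes of the shortcut: entrances, exits, and for each entrance the results in its Pareto
front. -/
abbrev ShortcutNode (A : OPG.{u} M mr ml nr nl) : Type :=
  ((Fin mr ⊕ Fin nl) ⊕ (Fin nr ⊕ Fin ml)) ⊕ (Σ i : Fin mr ⊕ Fin nl, A.paretoFront i)

/-- Edges of the shortcut. Exits have self-loops. -/
def shortcutE (A : OPG.{u} M mr ml nr nl) : A.ShortcutNode → A.ShortcutNode → Prop
  | .inl (.inl i), .inr x => x.1 = i
  | .inl (.inr o), .inl (.inr o') => o' = o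
  | .inr x, .inl (.inr o) => ∃ m, Dom.out o m ∈ x.2.1
  | .inr x, .inr y => y = x ∧ (Dom.win ∈ x.2.1 ∨ Dom.lose ∈ x.2.1)
  | _, _ => False

open Classical in
/-- Priorities of the shortcut. -/
noncomputable def shortcutPrio (A : OPG.{u} M mr ml nr nl) :
    A.ShortcutNode → A.ShortcutNode → Fin (M + 1)
  | .inr x, .inl (.inr o) => if h : ∃ m, Dom.out o m ∈ x.2.1 then h.choose else 0
  | .inr x, .inr _ => if Dom.lose ∈ x.2.1 then 1 else 0
  | _, _ => 0

theorem shortcutPrio_eq (A : OPG.{u} M mr ml nr nl) (x : Σ i : Fin mr ⊕ Fin nl, A.paretoFront i)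
    (o : Fin nr ⊕ Fin ml) (m : Fin (M + 1)) (h : Dom.out o m ∈ x.2.1) :
    A.shortcutPrio (.inr x) (.inl (.inr o)) = m := by
  have hex : ∃ m, Dom.out o m ∈ x.2.1 := ⟨m, h⟩
  simp only [shortcutPrio, dif_pos hex]
  exact A.out_unique x.2.2 hex.choose_spec h

/-- The shortcut open parity game. -/
noncomputable def shortcut (A : OPG.{u} M mr ml nr nl) : OPG.{0} M mr ml nr nl where
  V := A.ShortcutNode
  finite_V := inferInstance
  VE := Set.range Sum.inl
  E := A.shortcutE
  prio := A.shortcutPrio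
  exists_succ := by
    rintro ((i | o) | x)
    · obtain ⟨r, hr⟩ := A.paretoFront_nonempty i
      exact ⟨.inr ⟨i, r, hr⟩, rfl⟩
    · exact ⟨.inl (.inr o), rfl⟩
    · obtain ⟨d, hd⟩ := A.nonempty_of_mem_paretoFront x.2.2
      cases d with
      | lose => exact ⟨.inr x, rfl, .inr hd⟩
      | win => exact ⟨.inr x, rfl, .inl hd⟩
      | out o m => exact ⟨.inl (.inr o), m, hd⟩
  entr i := .inl (.inl i)
  exi o := .inl (.inr o)
  ends_injective := by
    rintro (a | a) (b | b) h <;> simpa using h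
  entr_mem _ := ⟨_, rfl⟩
  exi_mem _ := ⟨_, rfl⟩
  exi_sink := by
    rintro o ((i | o') | x) h
    · exact h.elim
    · exact congrArg (fun z => Sum.inl (Sum.inr z)) h
    · exact h.elim
  exi_prio _ := rfl

end shortcut

end OPG

/-! Everything is reduced to one relation between games with the same exits. `Dominated C C' i i'`
holds if every `∃`-strategy `σ` of `C` has a counterpart `σ'` in `C'` such that each play against
`σ'` is at least as good as some play against `σ`. Strategies of `∀` disappear from the argument,
since the plays against `σ` are exactly the infinite paths consistent with `σ` (`exists_play_iff`).
Domination in both directions forces equal Pareto fronts (`paretoFront_eq_of_dominated`), because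
sets of minimal elements are antichains and `UpperLe` is antisymmetric on antichains.

It remains to see that a game and its shortcut dominate each other, and that both compositions
preserve domination. The former holds because choosing `r` in the shortcut amounts to fixing a
strategy with outcome `r`, and because, the domain being finite, every outcome lies below one in the
Pareto front. For sums, a play never leaves the component in which it starts
(`Dominated.of_component`).

Sequential composition is the sum with some exits rewired to entrances, so the core is
`Dominated.wiring`. A play of the second game is cut at each wired exit. Inside a segment, `∃`
follows the strategy that dominates `σ` continued from a simulated history in the first game. When
the segment ends at the exit `o` with priority `m'`, domination returns a path against `σ` that
either loses without exiting, which settles the comparison, or reaches the same `o` with some `m ≼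
m'`; then both games continue from the same entrance. A finite number of segments is absorbed by
monotonicity of the maximum for `≼` (`subKey_sup_le_sup`), and infinitely many are compared by
`LimEven.mono`. -/

/-! ### Lists of visited nodes -/

/-- The first `n` values of a sequence. -/
def hist {V : Type*} (p : ℕ → V) (n : ℕ) : List V := (List.range n).map p

section hist

variable {V : Type*}

@[simp] theorem hist_zero (p : ℕ → V) : hist p 0 = [] := rfl

theorem hist_succ (p : ℕ → V) (n : ℕ) : hist p (n + 1) = hist p n ++ [p n] := by
  simp [hist, List.range_succ]

@[simp] theorem length_hist (p : ℕ → V) (n : ℕ) : (hist p n).length = n := by simp [hist]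

theorem hist_add (p : ℕ → V) (a b : ℕ) :
    hist p (a + b) = hist p a ++ hist (fun j => p (a + j)) b := by
  simp [hist, List.range_add, Function.comp_def]

theorem hist_congr {p q : ℕ → V} {n : ℕ} (h : ∀ k < n, p k = q k) : hist p n = hist q n :=
  List.map_congr_left fun k hk => h k (List.mem_range.1 hk)

theorem hist_comp {W : Type*} (f : V → W) (p : ℕ → V) (n : ℕ) :
    hist (fun k => f (p k)) n = (hist p n).map f := by
  simp [hist, Function.comp_def]

theorem getD_hist (p : ℕ → V) {n k : ℕ} (hk : k < n) (x : V) : (hist p n).getD k x = p k := by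
  simp [hist, hk]

/-- A sequence of finite segments can be concatenated. -/
theorem exists_concat {A : ℕ → ℕ} (hA : StrictMono A) (q : ℕ → ℕ → V) :
    ∃ p : ℕ → V, ∀ k j, A k + j < A (k + 1) → p (A k + j) = q k j := by
  classical
  have hex : ∀ n, ∃ k, n < A (k + 1) := fun n => ⟨n, (Nat.lt_succ_self n).trans_le (hA.id_le _)⟩
  refine ⟨fun n => q (Nat.find (hex n)) (n - A (Nat.find (hex n))), fun k j hj => ?_⟩
  have : Nat.find (hex (A k + j)) = k := by
    rw [Nat.find_eq_iff]
    refine ⟨hj, fun k' hk' h => ?_⟩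
    have := hA.monotone (show k' + 1 ≤ k from hk')
    omega
  simp [this]

theorem exists_segment {A : ℕ → ℕ} (hA : StrictMono A) (h0 : A 0 = 0) (n : ℕ) :
    ∃ k j, n = A k + j ∧ A k + j < A (k + 1) := by
  induction n with
  | zero => exact ⟨0, 0, by simp [h0], by have := hA (Nat.lt_succ_self 0); omega⟩
  | succ n ih =>
    obtain ⟨k, j, rfl, h⟩ := ih
    by_cases h' : A k + j + 1 < A (k + 1)
    · exact ⟨k, j + 1, rfl, h'⟩
    · have := hA (Nat.lt_succ_self (k + 1))
      exact ⟨k + 1, 0, by omega, by simpa using this⟩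

end hist

/-! ### Sequences of priorities -/

section priorities

open Filter

variable {M : ℕ}

/-- The largest value that occurs infinitely often is even. -/
def LimEven (f : ℕ → Fin (M + 1)) : Prop :=
  ∃ m : Fin (M + 1), Even m.val ∧ (∃ᶠ n in atTop, f n = m) ∧
    ∀ m', (∃ᶠ n in atTop, f n = m') → m' ≤ m

/-- `m` is the largest value that occurs infinitely often. -/
def IsLim (f : ℕ → Fin (M + 1)) (m : Fin (M + 1)) : Prop :=
  (∃ᶠ n in atTop, f n = m) ∧ ∀ᶠ n in atTop, f n ≤ m

/-- There are finitely many values, so "each value eventually fails" becomes "eventually all fail".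
This shows that some value recurs, and that the values above the largest recurring one eventually
stop. -/
theorem exists_isLim (f : ℕ → Fin (M + 1)) : ∃ m, IsLim f m := by
  classical
  let S : Finset (Fin (M + 1)) := {m | ∃ᶠ n in atTop, f n = m}
  have hS : S.Nonempty := by
    by_contra h
    rw [Finset.not_nonempty_iff_eq_empty] at h
    have h1 : ∀ m, ∀ᶠ n in atTop, f n ≠ m := fun m => by
      have : m ∉ S := by simp [h]
      simpa [S] using this
    obtain ⟨n, hn⟩ := (eventually_all.2 h1).exists
    exact hn (f n) rfl
  refine ⟨S.max' hS, by simpa [S] using S.max'_mem hS, ?_⟩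
  have h1 : ∀ m, ∀ᶠ n in atTop, S.max' hS < m → f n ≠ m := fun m => by
    by_cases hm : S.max' hS < m
    · have : m ∉ S := fun h => absurd (S.le_max' m h) (not_le.2 hm)
      simp only [S, Finset.mem_filter, Finset.mem_univ, true_and, not_frequently] at this
      exact this.mono fun n hn _ => hn
    · exact .of_forall fun n h => absurd h hm
  filter_upwards [eventually_all.2 h1] with n hn
  by_contra h
  exact hn (f n) (not_le.1 h) rfl

theorem IsLim.limEven_iff {f : ℕ → Fin (M + 1)} {m : Fin (M + 1)} (h : IsLim f m) :
    LimEven f ↔ Even m.val := by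
  have hle : ∀ m', (∃ᶠ n in atTop, f n = m') → m' ≤ m := fun m' h' => by
    obtain ⟨n, hn, hn'⟩ := (h'.and_eventually h.2).exists
    exact hn ▸ hn'
  constructor
  · rintro ⟨m', he, hf, hm⟩
    rwa [← le_antisymm (hle m' hf) (hm m h.1)]
  · exact fun he => ⟨m, he, h.1, hle⟩

theorem limEven_shift (f : ℕ → Fin (M + 1)) (N : ℕ) :
    LimEven (fun n => f (N + n)) ↔ LimEven f := by
  have key : ∀ m, (∃ᶠ n in atTop, f (N + n) = m) ↔ ∃ᶠ n in atTop, f n = m := fun m => by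
    simp only [frequently_atTop]
    constructor
    · intro h a
      obtain ⟨b, hb, rfl⟩ := h a
      exact ⟨N + b, by omega, rfl⟩
    · intro h a
      obtain ⟨b, hb, rfl⟩ := h (N + a)
      exact ⟨b - N, by omega, by congr; omega⟩
  simp only [LimEven, key]

theorem limEven_const (m : Fin (M + 1)) : LimEven (fun _ => m) ↔ Even m.val :=
  IsLim.limEven_iff ⟨(Eventually.of_forall fun _ => rfl).frequently, by simp⟩

/-- The segments `[A k, A (k + 1))` tile `ℕ`. Late segment maxima are bounded by `m`, and infinitely
many segments contain an occurrence of `m`. -/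
theorem IsLim.of_segments {f g : ℕ → Fin (M + 1)} {A : ℕ → ℕ} (hA : StrictMono A)
    (h0 : A 0 = 0)
    (hg : ∀ k, g k = (Finset.range (A (k + 1) - A k)).sup fun j => f (A k + j))
    {m : Fin (M + 1)} (h : IsLim f m) : IsLim g m := by
  obtain ⟨h1, h2⟩ := h
  have h2' : ∀ᶠ k in atTop, g k ≤ m := by
    obtain ⟨a, ha⟩ := eventually_atTop.1 h2
    refine eventually_atTop.2 ⟨a, fun k hk => ?_⟩
    rw [hg]
    exact Finset.sup_le fun j _ => ha _ (by have := hA.id_le k; simp only [id] at this; omega)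
  refine ⟨?_, h2'⟩
  have h3 : ∃ᶠ k in atTop, m ≤ g k := by
    rw [frequently_atTop] at h1 ⊢
    intro a
    obtain ⟨n, hn, hfn⟩ := h1 (A a)
    obtain ⟨k, j, rfl, hj⟩ := exists_segment hA h0 n
    refine ⟨k, ?_, ?_⟩
    · by_contra hk
      have := hA.monotone (show k + 1 ≤ a by omega)
      omega
    · rw [hg, ← hfn]
      exact Finset.le_sup (f := fun j => f (A k + j)) (Finset.mem_range.2 (by omega))
  exact (h3.and_eventually h2').mono fun k hk => le_antisymm hk.2 hk.1

theorem limEven_segments {f : ℕ → Fin (M + 1)} {A : ℕ → ℕ} (hA : StrictMono A) (h0 : A 0 = 0) :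
    LimEven f ↔ LimEven fun k => (Finset.range (A (k + 1) - A k)).sup fun j => f (A k + j) := by
  obtain ⟨m, hm⟩ := exists_isLim f
  rw [hm.limEven_iff, (hm.of_segments hA h0 fun _ => rfl).limEven_iff]

/-- Let `m` be the even limit of `f` and suppose that the limit `m'` of `g` is odd. Where `g k =
m'`, the value `f k` must be odd and at least `m'`, so `m' ≤ m`. Where `f k = m`, the value `g k`
must be even and at least `m`, so `m ≤ m'`. Hence `m = m'`, contradicting parity. -/
theorem LimEven.mono {f g : ℕ → Fin (M + 1)} (h : ∀ k, subKey (f k) ≤ subKey (g k))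
    (hf : LimEven f) : LimEven g := by
  obtain ⟨m, hm⟩ := exists_isLim f
  obtain ⟨m', hm'⟩ := exists_isLim g
  rw [hm.limEven_iff] at hf
  rw [hm'.limEven_iff]
  by_contra ho
  have h1 : m' ≤ m := by
    obtain ⟨n, hn, hn'⟩ := (hm'.1.and_eventually hm.2).exists
    refine le_trans ?_ hn'
    have := h n
    rw [hn] at this
    unfold subKey at this
    rw [if_neg ho] at this
    rw [Fin.le_def]
    split_ifs at this <;> omega
  have h2 : m ≤ m' := by
    obtain ⟨n, hn, hn'⟩ := (hm.1.and_eventually hm'.2).exists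
    refine le_trans ?_ hn'
    have := h n
    rw [hn] at this
    unfold subKey at this
    rw [if_pos hf] at this
    rw [Fin.le_def]
    split_ifs at this <;> omega
  rw [le_antisymm h1 h2] at ho
  exact ho hf

/-- Say `a'` is the larger of `a'`, `b'`. If it is odd, then `a` is odd with `a ≥ a'`, and `b`, if
even, is at most `b' ≤ a'`; so the left maximum is odd and no smaller. If it is even, then any even
number among `a`, `b` is at most `a'`, and an odd left maximum is below anyway. -/
theorem subKey_sup_le_sup {a a' b b' : Fin (M + 1)} (ha : subKey a ≤ subKey a')
    (hb : subKey b ≤ subKey b') : subKey (a ⊔ b) ≤ subKey (a' ⊔ b') := by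
  have h1 : ∀ x y : Fin (M + 1), (x ⊔ y).val = max x.val y.val := fun x y => by
    rcases le_total x y with h | h
    · rw [sup_eq_right.2 h, max_eq_right (Fin.le_def.1 h)]
    · rw [sup_eq_left.2 h, max_eq_left (Fin.le_def.1 h)]
  unfold subKey at *
  rw [h1, h1]
  simp only [Nat.even_iff] at *
  split_ifs at * <;> omega

end priorities

/-! ### The domain -/

namespace Dom

variable {M : ℕ} {O : Type}

/-- The effect on the denotation of a play of prepending a finite path of maximal priority `m`. -/
def prepend (m : Fin (M + 1)) : Dom M O → Dom M O
  | lose => lose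
  | win => win
  | out o k => out o (m ⊔ k)

theorem prepend_mono {m m' : Fin (M + 1)} (h : subKey m ≤ subKey m') {d d' : Dom M O}
    (hd : d ≤ d') : prepend m d ≤ prepend m' d' := by
  cases hd with
  | lose_le => exact .lose_le _
  | le_win => exact .le_win _
  | out_le_out o k k' hk => exact .out_le_out _ _ _ (subKey_sup_le_sup h hk)

theorem lose_le' (d : Dom M O) : lose ≤ d := .lose_le d

theorem le_win' (d : Dom M O) : d ≤ win := .le_win d

theorem out_le_out_iff {o o' : O} {m m' : Fin (M + 1)} :
    (out o m : Dom M O) ≤ out o' m' ↔ o = o' ∧ subKey m ≤ subKey m' := by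
  constructor
  · intro h
    cases h with
    | out_le_out _ _ _ h => exact ⟨rfl, h⟩
  · rintro ⟨rfl, h⟩
    exact .out_le_out _ _ _ h

theorem eq_lose_of_le {d : Dom M O} (h : d ≤ lose) : d = lose := by
  cases h; rfl

theorem eq_of_le_out {d : Dom M O} {o : O} {m' : Fin (M + 1)} (h : d ≤ out o m') :
    d = lose ∨ ∃ m, d = out o m ∧ subKey m ≤ subKey m' := by
  cases h with
  | lose_le => exact .inl rfl
  | out_le_out _ m _ h => exact .inr ⟨m, rfl, h⟩

theorem UpperLe.trans {T₁ T₂ T₃ : Set (Dom M O)} (h₁ : UpperLe T₁ T₂) (h₂ : UpperLe T₂ T₃) :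
    UpperLe T₁ T₃ := fun d hd => by
  obtain ⟨e, he, hed⟩ := h₂ d hd
  obtain ⟨f, hf, hfe⟩ := h₁ e he
  exact ⟨f, hf, hfe.trans hed⟩

theorem UpperLe.refl (T : Set (Dom M O)) : UpperLe T T := fun d hd => ⟨d, hd, le_rfl⟩

/-- Going down from `d` to some `e` on the other side and back to some `f` gives `f ≤ e ≤ d`;
minimality of `d` collapses the chain. -/
theorem UpperLe.worst_subset {T₁ T₂ : Set (Dom M O)} (h₁ : UpperLe (worst T₁) (worst T₂))
    (h₂ : UpperLe (worst T₂) (worst T₁)) : worst T₂ ⊆ worst T₁ := fun d hd => by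
  obtain ⟨e, he, hed⟩ := h₁ d hd
  obtain ⟨f, hf, hfe⟩ := h₂ e he
  rw [le_antisymm (hd.2 hf.1 (hfe.trans hed) |>.trans hfe) hed]
  exact he

theorem UpperLe.worst_antisymm {T₁ T₂ : Set (Dom M O)} (h₁ : UpperLe (worst T₁) (worst T₂))
    (h₂ : UpperLe (worst T₂) (worst T₁)) : worst T₁ = worst T₂ :=
  (h₂.worst_subset h₁).antisymm (h₁.worst_subset h₂)

theorem upperLe_worst [Finite O] (T : Set (Dom M O)) : UpperLe (worst T) T := fun d hd => by
  obtain ⟨e, he, hmin⟩ := (Set.toFinite T).exists_le_minimal hd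
  exact ⟨e, hmin, he⟩

theorem upperLe_worst_iff [Finite O] {T₁ T₂ : Set (Dom M O)} :
    UpperLe (worst T₁) (worst T₂) ↔ UpperLe T₁ T₂ := by
  have key : ∀ T : Set (Dom M O), UpperLe T (worst T) := fun T d hd => ⟨d, hd.1, le_rfl⟩
  exact ⟨fun h => ((key T₁).trans h).trans (upperLe_worst T₂),
    fun h => ((upperLe_worst T₁).trans h).trans (key T₂)⟩

/-- By transitivity, a set that is maximal among those above `T` is maximal in all of `S`. -/
theorem exists_best_ge [Finite O] {S : Set (Set (Dom M O))} {T : Set (Dom M O)} (hT : T ∈ S) :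
    ∃ T' ∈ best S, UpperLe T T' := by
  obtain ⟨T', ⟨hT', hle⟩, hmax⟩ := best_nonempty (S := {T' | T' ∈ S ∧ UpperLe T T'})
    ⟨T, hT, .refl T⟩
  exact ⟨T', ⟨hT', fun U hU h => hmax U ⟨hU, hle.trans h⟩ h⟩, hle⟩

/-- From a maximal `worst (F a)`, going up to the other family and back up again cannot gain
anything. So the intermediate set is equivalent to `worst (F a)`, and equal to it by antisymmetry on
antichains. -/
theorem best_subset {ι κ : Type*} {F : ι → Set (Dom M O)} {G : κ → Set (Dom M O)}
    (hFG : ∀ a, ∃ b, UpperLe (worst (F a)) (worst (G b)))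
    (hGF : ∀ b, ∃ a, UpperLe (worst (G b)) (worst (F a))) :
    best {T | ∃ a, worst (F a) = T} ⊆ best {T | ∃ b, worst (G b) = T} := by
  rintro _ ⟨⟨a, rfl⟩, hmax⟩
  obtain ⟨b, hb⟩ := hFG a
  obtain ⟨a', ha'⟩ := hGF b
  have h := (ha'.trans (hmax _ ⟨a', rfl⟩ (hb.trans ha')))
  refine ⟨⟨b, h.worst_antisymm hb⟩, ?_⟩
  rintro _ ⟨b', rfl⟩ hle
  obtain ⟨a'', ha''⟩ := hGF b'
  exact ha''.trans (hmax _ ⟨a'', rfl⟩ (hle.trans ha''))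

end Dom

/-! ### Arenas -/

/-- The data of an open parity game on which its Pareto fronts depend. -/
structure Arena (M : ℕ) (V : Type*) (I O : Type) where
  VE : Set V
  E : V → V → Prop
  prio : V → V → Fin (M + 1)
  exists_succ : ∀ x, ∃ y, E x y
  entr : I → V
  exi : O → V
  exi_injective : Function.Injective exi
  entr_ne_exi : ∀ i o, entr i ≠ exi o
  exi_sink : ∀ o x, E (exi o) x → x = exi o
  exi_prio : ∀ o, prio (exi o) (exi o) = 0

namespace Arena

variable {M : ℕ} {V : Type*} {I O : Type} (C : Arena M V I O)

/-- A choice of an edge after every history. Only the choices at nodes in `VE` matter. -/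
structure Strat where
  move : List V → V → V
  valid : ∀ h x, C.E x (move h x)

/-- The infinite paths from `x` that are consistent with `σ`. -/
def Play (σ : C.Strat) (x : V) (p : ℕ → V) : Prop :=
  p 0 = x ∧ ∀ n, C.E (p n) (p (n + 1)) ∧ (p n ∈ C.VE → p (n + 1) = σ.move (hist p n) (p n))

open Classical in
/-- The denotation of a play. -/
noncomputable def den (p : ℕ → V) : Dom M O :=
  if h : ∃ j, ∃ o, p j = C.exi o then
    Dom.out (Nat.find_spec h).choose
      ((Finset.range (Nat.find h)).sup fun k => C.prio (p k) (p (k + 1)))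
  else if LimEven (fun n => C.prio (p n) (p (n + 1))) then Dom.win else Dom.lose

/-- Every `∃`-strategy of `C` from `i` is dominated by one of `C'` from `i'`. -/
def Dominated {V' : Type*} {I' : Type} (C' : Arena M V' I' O) (i : I) (i' : I') : Prop :=
  ∀ σ : C.Strat, ∃ σ' : C'.Strat, ∀ p', C'.Play σ' (C'.entr i') p' →
    ∃ p, C.Play σ (C.entr i) p ∧ C.den p ≤ C'.den p'

variable {C}

/-- The strategy that `σ` prescribes after the history `h`. -/
def Strat.shift (σ : C.Strat) (h : List V) : C.Strat where
  move l x := σ.move (h ++ l) x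
  valid _ _ := σ.valid _ _

@[simp] theorem Strat.shift_nil (σ : C.Strat) : σ.shift [] = σ := rfl

theorem Strat.exists_play (σ : C.Strat) (x : V) : ∃ p, C.Play σ x p := by
  let r : ℕ → List V × V := fun n => n.rec ([], x) fun _ s => (s.1 ++ [s.2], σ.move s.1 s.2)
  have h : ∀ n, (r n).1 = hist (fun k => (r k).2) n := fun n => by
    induction n with
    | zero => rfl
    | succ n ih => rw [hist_succ, ← ih]
  exact ⟨fun n => (r n).2, rfl, fun n => ⟨σ.valid _ _, fun _ => by rw [← h n]⟩⟩

theorem eq_exi_of_le {p : ℕ → V} (hp : ∀ n, C.E (p n) (p (n + 1))) {e : ℕ} {o : O}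
    (he : p e = C.exi o) {n : ℕ} (hn : e ≤ n) : p n = C.exi o := by
  induction n, hn using Nat.le_induction with
  | base => exact he
  | succ n _ ih => exact C.exi_sink _ _ (ih ▸ hp n)

/-- Any time `e` at the exit will do, not only the first: the play stays there on a self-loop of
priority `0`, which does not change the maximum. -/
theorem den_of_exit {p : ℕ → V} (hp : ∀ n, C.E (p n) (p (n + 1))) {e : ℕ} {o : O}
    (he : p e = C.exi o) :
    C.den p = .out o ((Finset.range e).sup fun k => C.prio (p k) (p (k + 1))) := by
  classical
  have h : ∃ j, ∃ o, p j = C.exi o := ⟨e, o, he⟩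
  have hspec := (Nat.find_spec h).choose_spec
  have hle : Nat.find h ≤ e := Nat.find_min' h ⟨o, he⟩
  have ho : (Nat.find_spec h).choose = o :=
    C.exi_injective ((eq_exi_of_le hp hspec hle).symm.trans he)
  unfold den
  rw [dif_pos h]
  congr 1
  rw [ho] at hspec
  refine le_antisymm (Finset.sup_mono (Finset.range_subset_range.2 hle)) (Finset.sup_le ?_)
  intro k hk
  by_cases hk' : k < Nat.find h
  · exact Finset.le_sup (f := fun k => C.prio (p k) (p (k + 1))) (Finset.mem_range.2 hk')
  · rw [eq_exi_of_le hp hspec (not_lt.1 hk'), eq_exi_of_le hp hspec (Nat.le_succ_of_le (not_lt.1 hk')),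
      C.exi_prio]
    exact Fin.zero_le _

open Classical in
theorem den_of_no_exit {p : ℕ → V} (hp : ∀ n o, p n ≠ C.exi o) :
    C.den p = if LimEven (fun n => C.prio (p n) (p (n + 1))) then .win else .lose := by
  unfold den
  rw [dif_neg]
  rintro ⟨n, o, h⟩
  exact hp n o h

theorem den_eq_out {p : ℕ → V} {o : O} {m : Fin (M + 1)} (h : C.den p = .out o m) :
    ∃ e, p e = C.exi o ∧ (∀ k < e, ∀ o', p k ≠ C.exi o') ∧
      m = (Finset.range e).sup fun k => C.prio (p k) (p (k + 1)) := by
  classical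
  unfold den at h
  split_ifs at h with hex
  injection h with h1 h2
  exact ⟨Nat.find hex, h1 ▸ (Nat.find_spec hex).choose_spec,
    fun k hk o' hk' => Nat.find_min hex hk ⟨o', hk'⟩, h2.symm⟩

theorem no_exit_of_den_eq_lose {p : ℕ → V} (h : C.den p = .lose) : ∀ n o, p n ≠ C.exi o := by
  classical
  intro n o hn
  unfold den at h
  rw [dif_pos ⟨n, o, hn⟩] at h
  cases h

/-- A prefix without exits contributes to the maximum if an exit follows, and is invisible to the
parity condition otherwise. -/
theorem den_prepend {p : ℕ → V} (hp : ∀ n, C.E (p n) (p (n + 1))) {N : ℕ}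
    (hN : ∀ k < N, ∀ o, p k ≠ C.exi o) :
    C.den p = .prepend ((Finset.range N).sup fun k => C.prio (p k) (p (k + 1)))
      (C.den fun j => p (N + j)) := by
  classical
  by_cases h : ∃ e o, p e = C.exi o
  · obtain ⟨e, o, he⟩ := h
    have hNe : N ≤ e := by
      by_contra hc
      exact hN e (not_le.1 hc) o he
    obtain ⟨e, rfl⟩ := Nat.exists_eq_add_of_le hNe
    rw [den_of_exit hp he, den_of_exit (p := fun j => p (N + j)) (e := e) (fun n => hp (N + n)) he]
    simp only [Dom.prepend]
    congr 1
    refine le_antisymm (Finset.sup_le fun k hk => ?_)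
      (sup_le (Finset.sup_mono (Finset.range_subset_range.2 hNe)) (Finset.sup_le fun k hk => ?_))
    · by_cases hk' : k < N
      · exact le_sup_of_le_left
          (Finset.le_sup (f := fun k => C.prio (p k) (p (k + 1))) (Finset.mem_range.2 hk'))
      · obtain ⟨k, rfl⟩ := Nat.exists_eq_add_of_le (not_lt.1 hk')
        refine le_sup_of_le_right
          (Finset.le_sup (f := fun k => C.prio (p (N + k)) (p (N + (k + 1)))) ?_)
        rw [Finset.mem_range] at hk ⊢
        omega
    · refine Finset.le_sup (f := fun k => C.prio (p k) (p (k + 1))) (b := N + k) ?_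
      rw [Finset.mem_range] at hk ⊢
      omega
  · push Not at h
    rw [den_of_no_exit h, den_of_no_exit fun n => h (N + n)]
    have := limEven_shift (fun n => C.prio (p n) (p (n + 1))) N
    simp only [add_assoc] at this
    rw [this]
    split_ifs <;> rfl

end Arena

namespace Arena

/-! ### Matching plays segment by segment -/

section matching

variable {M : ℕ} {V V' : Type*} {J J' P : Type} {G : Arena M V J P} {G' : Arena M V' J' P}

variable (G G') in
/-- The first `N` steps of `q` are consistent with `σ` after the history `h`, and they are at most
as good as `N'` steps of `p'` from time `t` on. -/
structure Matched (σ : G.Strat) (p' : ℕ → V') (h : List V) (t : ℕ) (q : ℕ → V) (N N' : ℕ) :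
    Prop where
  pos : 0 < N
  pos' : 0 < N'
  edge : ∀ k < N, G.E (q k) (q (k + 1))
  consistent : ∀ k < N, q k ∈ G.VE → q (k + 1) = σ.move (h ++ hist q k) (q k)
  no_exit : ∀ k < N, ∀ o, q k ≠ G.exi o
  no_exit' : ∀ k < N', ∀ o, p' (t + k) ≠ G'.exi o
  le : subKey ((Finset.range N).sup fun k => G.prio (q k) (q (k + 1))) ≤
    subKey ((Finset.range N').sup fun k => G'.prio (p' (t + k)) (p' (t + (k + 1))))

/-- A witness for the remainder of `p'` is spliced after the segment `q`; `Dom.prepend_mono` carries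
the comparison over. This makes failure propagate forwards in `Dominated.wiring`. -/
theorem Matched.exists_play {σ : G.Strat} {p' : ℕ → V'} {h : List V} {t : ℕ} {q : ℕ → V}
    {N N' : ℕ} (hm : Matched G G' σ p' h t q N N') (hp' : ∀ n, G'.E (p' n) (p' (n + 1)))
    (hp : ∃ p, G.Play (σ.shift (h ++ hist q N)) (q N) p ∧
      G.den p ≤ G'.den fun j => p' (t + N' + j)) :
    ∃ p, G.Play (σ.shift h) (q 0) p ∧ G.den p ≤ G'.den fun j => p' (t + j) := by
  obtain ⟨p, ⟨hp0, hp⟩, hle⟩ := hp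
  let c : ℕ → V := fun n => if n < N then q n else p (n - N)
  have c_lt : ∀ n, n ≤ N → c n = q n := fun n hn => by
    rcases hn.lt_or_eq with hn | rfl
    · simp [c, hn]
    · simp [c, hp0]
  have c_add : ∀ n, c (N + n) = p n := fun n => by simp [c]
  have c_hist : ∀ n, n ≤ N → hist c n = hist q n := fun n hn =>
    hist_congr fun k hk => c_lt k (by omega)
  have hE : ∀ n, G.E (c n) (c (n + 1)) := fun n => by
    by_cases hn : n < N
    · rw [c_lt n hn.le, c_lt (n + 1) hn]
      exact hm.edge n hn
    · obtain ⟨n, rfl⟩ := Nat.exists_eq_add_of_le (not_lt.1 hn)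
      rw [add_assoc, c_add, c_add]
      exact (hp n).1
  refine ⟨c, ⟨c_lt 0 (Nat.zero_le _), fun n => ⟨hE n, ?_⟩⟩, ?_⟩
  · by_cases hn : n < N
    · rw [c_lt n hn.le, c_lt (n + 1) hn, c_hist n hn.le]
      exact hm.consistent n hn
    · obtain ⟨n, rfl⟩ := Nat.exists_eq_add_of_le (not_lt.1 hn)
      rw [add_assoc, c_add, c_add, hist_add, c_hist N le_rfl]
      simp only [c_add]
      intro h'
      rw [(hp n).2 h']
      simp [Strat.shift]
  · rw [den_prepend hE (N := N) fun k hk o => by rw [c_lt k hk.le]; exact hm.no_exit k hk o,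
      den_prepend (p := fun j => p' (t + j)) (fun n => hp' (t + n)) hm.no_exit']
    refine Dom.prepend_mono ?_ ?_
    · refine le_of_eq_of_le (congrArg _ (Finset.sup_congr rfl fun k hk => ?_)) hm.le
      rw [Finset.mem_range] at hk
      rw [c_lt k hk.le, c_lt (k + 1) hk]
    · simpa only [c_add, add_assoc] using hle

/-- With infinitely many segments neither play reaches an exit, so parity decides both. Replacing
the priorities by segment maxima changes neither result, and these maxima are compared termwise. -/
theorem exists_play_of_matched {σ : G.Strat} {p' : ℕ → V'} {h : ℕ → List V} {t : ℕ → ℕ}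
    {q : ℕ → ℕ → V} {N N' : ℕ → ℕ} (h0 : h 0 = []) (t0 : t 0 = 0)
    (hm : ∀ k, Matched G G' σ p' (h k) (t k) (q k) (N k) (N' k))
    (hh : ∀ k, h (k + 1) = h k ++ hist (q k) (N k)) (ht : ∀ k, t (k + 1) = t k + N' k)
    (hq : ∀ k, q k (N k) = q (k + 1) 0) :
    ∃ p, G.Play σ (q 0 0) p ∧ G.den p ≤ G'.den p' := by
  classical
  let A : ℕ → ℕ := fun k => (h k).length
  have hA : ∀ k, A (k + 1) = A k + N k := fun k => by simp [A, hh]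
  have hA0 : A 0 = 0 := by simp [A, h0]
  have hmono : StrictMono A := strictMono_nat_of_lt_succ fun k => by
    have := (hm k).pos
    rw [hA]
    omega
  have hmono' : StrictMono t := strictMono_nat_of_lt_succ fun k => by
    have := (hm k).pos'
    rw [ht]
    omega
  obtain ⟨p, hp⟩ := exists_concat hmono q
  have hp1 : ∀ k j, j ≤ N k → p (A k + j) = q k j := fun k j hj => by
    rcases hj.lt_or_eq with hj | rfl
    · exact hp k j (by rw [hA]; omega)
    · have h1 := hp (k + 1) 0 (by have := hmono (Nat.lt_succ_self (k + 1)); omega)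
      rw [← hA, hq]
      simpa using h1
  have hseg : ∀ n, ∃ k j, n = A k + j ∧ j < N k := fun n => by
    obtain ⟨k, j, h1, h2⟩ := exists_segment hmono hA0 n
    exact ⟨k, j, h1, by rw [hA] at h2; omega⟩
  have hhist : ∀ k, hist p (A k) = h k := fun k => by
    induction k with
    | zero => rw [hA0, h0, hist_zero]
    | succ k ih =>
      rw [hA, hist_add, ih, hh]
      exact congrArg _ (hist_congr fun j hj => hp1 k j hj.le)
  have hno : ∀ n o, p n ≠ G.exi o := fun n o => by
    obtain ⟨k, j, rfl, hj⟩ := hseg n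
    rw [hp1 k j hj.le]
    exact (hm k).no_exit j hj o
  have hno' : ∀ n o, p' n ≠ G'.exi o := fun n o => by
    obtain ⟨k, j, rfl, hj⟩ := exists_segment hmono' t0 n
    exact (hm k).no_exit' j (by rw [ht] at hj; omega) o
  refine ⟨p, ⟨?_, fun n => ?_⟩, ?_⟩
  · have := hp1 0 0 (Nat.zero_le _)
    rwa [hA0] at this
  · obtain ⟨k, j, rfl, hj⟩ := hseg n
    have h1 := hp1 k j hj.le
    have h2 : p (A k + j + 1) = q k (j + 1) := hp1 k (j + 1) hj
    rw [h1, h2, hist_add, hhist, hist_congr (q := q k) fun i hi => hp1 k i (by omega)]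
    exact ⟨(hm k).edge j hj, (hm k).consistent j hj⟩
  · rw [den_of_no_exit hno, den_of_no_exit hno']
    have : LimEven (fun n => G.prio (p n) (p (n + 1))) →
        LimEven (fun n => G'.prio (p' n) (p' (n + 1))) := by
      rw [limEven_segments (f := fun n => G.prio (p n) (p (n + 1))) hmono hA0,
        limEven_segments (f := fun n => G'.prio (p' n) (p' (n + 1))) hmono' t0]
      refine LimEven.mono fun k => ?_
      rw [hA, ht, Nat.add_sub_cancel_left, Nat.add_sub_cancel_left]
      refine le_of_eq_of_le (congrArg _ (Finset.sup_congr rfl fun j hj => ?_)) (hm k).le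
      rw [Finset.mem_range] at hj
      rw [hp1 k j hj.le]
      exact congrArg _ (hp1 k (j + 1) hj)
    split_ifs with hc hc'
    · exact le_rfl
    · exact absurd (this hc) hc'
    · exact Dom.le_win' _
    · exact le_rfl

end matching

/-! ### Connecting exits to entrances -/

/-- `G` arises from `C` by replacing, for `w o = some i`, the self-loop at the exit `o` by an edge
to the entrance `i`. -/
structure IsWiring {M : ℕ} {V : Type*} {I O J P : Type} (G : Arena M V J P) (C : Arena M V I O)
    (a : J → I) (b : P → O) (w : O → Option I) : Prop where
  VE_eq : G.VE = C.VE
  edge_iff : ∀ x y, G.E x y ↔ (C.E x y ∧ ∀ i o, w o = some i → x ≠ C.exi o) ∨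
    ∃ i o, w o = some i ∧ x = C.exi o ∧ y = C.entr i
  prio_eq : ∀ x y, G.prio x y = C.prio x y
  prio_wire : ∀ i o, w o = some i → C.prio (C.exi o) (C.entr i) = 0
  entr_eq : ∀ j, G.entr j = C.entr (a j)
  exi_eq : ∀ q, G.exi q = C.exi (b q)
  wire_eq_none : ∀ q, w (b q) = none
  exists_eq : ∀ o, w o = none → ∃ q, b q = o

section wiring

variable {M : ℕ} {V V' : Type*} {I O J P : Type}

/-- The node `x` is an exit that is connected to an entrance. -/
def Wired (C : Arena M V I O) (w : O → Option I) (x : V) : Prop :=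
  ∃ i o, w o = some i ∧ x = C.exi o

namespace IsWiring

variable {G : Arena M V J P} {C : Arena M V I O} {a : J → I} {b : P → O} {w : O → Option I}

theorem edge_of_not_wired (hG : IsWiring G C a b w) {x y : V} (hx : ¬ C.Wired w x) :
    G.E x y ↔ C.E x y := by
  rw [hG.edge_iff]
  constructor
  · rintro (h | ⟨i, o, h, hx', -⟩)
    · exact h.1
    · exact absurd ⟨i, o, h, hx'⟩ hx
  · exact fun h => .inl ⟨h, fun i o h' hx' => hx ⟨i, o, h', hx'⟩⟩

theorem edge_exi (hG : IsWiring G C a b w) {i : I} {o : O} (h : w o = some i) {y : V} :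
    G.E (C.exi o) y ↔ y = C.entr i := by
  rw [hG.edge_iff]
  constructor
  · rintro (h' | ⟨i', o', h', ho, rfl⟩)
    · exact absurd rfl (h'.2 i o h)
    · cases C.exi_injective ho
      rw [h] at h'
      cases h'
      rfl
  · rintro rfl
    exact .inr ⟨i, o, h, rfl, rfl⟩

theorem exi_ne_of_wired (hG : IsWiring G C a b w) {x : V} (hx : C.Wired w x) (o : P) :
    x ≠ G.exi o := by
  rintro rfl
  obtain ⟨i, o', h, ho⟩ := hx
  rw [hG.exi_eq] at ho
  rw [← C.exi_injective ho, hG.wire_eq_none] at h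
  cases h

theorem wired_or_exists (hG : IsWiring G C a b w) (o : O) :
    C.Wired w (C.exi o) ∨ ∃ q, o = b q := by
  cases h : w o with
  | none => exact .inr ((hG.exists_eq o h).imp fun _ h => h.symm)
  | some i => exact .inl ⟨i, o, h, rfl⟩

end IsWiring

open Classical in
/-- The strategy on `C` that follows the strategy `σ` on a wiring of `C` after the history `h`. -/
noncomputable def localStrat {G : Arena M V J P} (C : Arena M V I O) (σ : G.Strat) (h : List V) :
    C.Strat where
  move l x := if C.E x (σ.move (h ++ l) x) then σ.move (h ++ l) x else (C.exists_succ x).choose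
  valid l x := by
    split_ifs with hx
    · exact hx
    · exact (C.exists_succ x).choose_spec

namespace IsWiring

variable {G : Arena M V J P} {C : Arena M V I O} {a : J → I} {b : P → O} {w : O → Option I}

/-- Away from wired exits `G` and `C` have the same edges, so the fallback move in `localStrat` is
never used there. -/
theorem localStrat_move (hG : IsWiring G C a b w) (σ : G.Strat) (h l : List V) {x : V}
    (hx : ¬ C.Wired w x) : (localStrat C σ h).move l x = σ.move (h ++ l) x :=
  if_pos ((hG.edge_of_not_wired hx).1 (σ.valid _ _))

theorem play_of_not_wired (hG : IsWiring G C a b w) {σ : G.Strat} {h : List V} {x : V}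
    {p : ℕ → V} (hp : C.Play (localStrat C σ h) x p) (hw : ∀ n, ¬ C.Wired w (p n)) :
    G.Play (σ.shift h) x p :=
  ⟨hp.1, fun n => ⟨(hG.edge_of_not_wired (hw n)).2 (hp.2 n).1, fun hx =>
    ((hp.2 n).2 (hG.VE_eq ▸ hx)).trans (hG.localStrat_move σ h _ (hw n))⟩⟩

theorem den_of_exit (hG : IsWiring G C a b w) {p : ℕ → V} (hp : ∀ n, G.E (p n) (p (n + 1)))
    {o : P} {m : Fin (M + 1)} (h : C.den p = .out (b o) m) : G.den p = .out o m := by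
  obtain ⟨e, he, -, rfl⟩ := den_eq_out h
  rw [Arena.den_of_exit hp (he.trans (hG.exi_eq o).symm)]
  exact congrArg _ (Finset.sup_congr rfl fun k _ => hG.prio_eq _ _)

theorem den_of_no_exit (hG : IsWiring G C a b w) {p : ℕ → V} (hp : ∀ n o, p n ≠ C.exi o) :
    (G.den p = .win ∧ C.den p = .win) ∨ (G.den p = .lose ∧ C.den p = .lose) := by
  rw [Arena.den_of_no_exit hp,
    Arena.den_of_no_exit (C := G) fun n o => by rw [hG.exi_eq]; exact hp n _]
  rw [show (fun n => G.prio (p n) (p (n + 1))) = fun n => C.prio (p n) (p (n + 1)) from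
    funext fun n => hG.prio_eq _ _]
  split_ifs <;> simp

end IsWiring

/-! ### Transferring a strategy across a wiring -/

/-- The path that follows `s` and stays at its last node. -/
def stayPath (x : V) (s : List V) (n : ℕ) : V := s.getD (min n (s.length - 1)) x

theorem stayPath_hist (x : V) (q : ℕ → V) (e : ℕ) :
    stayPath x (hist q (e + 1)) = fun n => q (min n e) := by
  funext n
  unfold stayPath
  rw [length_hist, Nat.add_sub_cancel]
  exact getD_hist q (Nat.lt_succ_of_le (min_le_right _ _)) x

open Classical in
/-- A play against `σ` after the history `h` that is at most as good as the path `s`. -/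
noncomputable def answer {G : Arena M V J P} (C : Arena M V I O) (C' : Arena M V' I O)
    (σ : G.Strat) (h : List V) (i : I) (s : List V') : ℕ → V :=
  if hp : ∃ p, C.Play (localStrat C σ h) (C.entr i) p ∧ C.den p ≤ C'.den (stayPath (C'.entr i) s)
  then hp.choose else fun _ => C.entr i

open Classical in
/-- The first time that `p` is at an exit. -/
noncomputable def exitTime (C : Arena M V I O) (p : ℕ → V) : ℕ :=
  if h : ∃ e o, p e = C.exi o then Nat.find h else 0

theorem exitTime_eq {C : Arena M V I O} {p : ℕ → V} {e : ℕ} {o : O} (he : p e = C.exi o)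
    (h : ∀ k < e, ∀ o, p k ≠ C.exi o) : C.exitTime p = e := by
  classical
  unfold exitTime
  rw [dif_pos ⟨e, o, he⟩, Nat.find_eq_iff]
  exact ⟨⟨o, he⟩, fun k hk ⟨o', h'⟩ => h k hk o' h'⟩

open Classical in
/-- The memory of the strategy on the wiring of `C'`: a history `h` of the wiring of `C`, the
entrance at which the components were entered most recently, and the path since then. -/
noncomputable def memory {G : Arena M V J P} (C : Arena M V I O) (C' : Arena M V' I O)
    (w : O → Option I) (σ : G.Strat) (s : List V × I × List V') (x : V') : List V × I × List V' :=
  if hx : C'.Wired w x then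
    (s.1 ++ hist (answer C C' σ s.1 s.2.1 (s.2.2 ++ [x]))
      (C.exitTime (answer C C' σ s.1 s.2.1 (s.2.2 ++ [x])) + 1), hx.choose, [])
  else (s.1, s.2.1, s.2.2 ++ [x])

variable {G : Arena M V J P} {G' : Arena M V' J P} {C : Arena M V I O} {C' : Arena M V' I O}
  {a : J → I} {b : P → O} {w : O → Option I}

open Classical in
/-- The strategy on the wiring of `C'` that dominates `σ`. -/
noncomputable def wireStrat (hG' : IsWiring G' C' a b w) (H : ∀ i, Dominated C C' i i)
    (σ : G.Strat) (i₀ : I) : G'.Strat where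
  move l x := if hx : C'.Wired w x then C'.entr hx.choose else
    (H (l.foldl (memory C C' w σ) ([], i₀, [])).2.1
      (localStrat C σ (l.foldl (memory C C' w σ) ([], i₀, [])).1)).choose.move
      (l.foldl (memory C C' w σ) ([], i₀, [])).2.2 x
  valid l x := by
    split_ifs with hx
    · obtain ⟨o, ho, hxo⟩ := hx.choose_spec
      conv => arg 2; rw [hxo]
      exact (hG'.edge_exi ho).2 rfl
    · exact (hG'.edge_of_not_wired hx).2 (Strat.valid _ _ _)

/-- One round of the simulation, from a time `t` at which a segment begins. Either the comparison is
already decided by a play that stays inside the components, or both sides pass the same wire and the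
memory is again at the start of a segment. -/
theorem matched_or_exists_play (hG : IsWiring G C a b w) (hG' : IsWiring G' C' a b w)
    (H : ∀ i, Dominated C C' i i) {σ : G.Strat} {i₀ : I} {x₀ : V'} {p' : ℕ → V'}
    (hp' : G'.Play (wireStrat hG' H σ i₀) x₀ p') {t : ℕ} {h : List V} {i : I}
    (hst : (hist p' t).foldl (memory C C' w σ) ([], i₀, []) = (h, i, []))
    (ht : p' t = C'.entr i) :
    (∃ p, G.Play (σ.shift h) (C.entr i) p ∧ G.den p ≤ G'.den fun j => p' (t + j)) ∨
    ∃ q N N' i', Matched G G' σ p' h t q N N' ∧ q 0 = C.entr i ∧ q N = C.entr i' ∧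
      (hist p' (t + N')).foldl (memory C C' w σ) ([], i₀, []) = (h ++ hist q N, i', []) ∧
      p' (t + N') = C'.entr i' := by
  classical
  set R := (H i (localStrat C σ h)).choose with hR
  have hRspec := (H i (localStrat C σ h)).choose_spec
  rw [← hR] at hRspec
  set q' : ℕ → V' := fun j => p' (t + j) with hq'
  have hstate : ∀ k, (∀ j < k, ¬ C'.Wired w (q' j)) →
      (hist p' (t + k)).foldl (memory C C' w σ) ([], i₀, []) = (h, i, hist q' k) := by
    intro k hk
    induction k with
    | zero => exact hst
    | succ k ih =>
      rw [← add_assoc, hist_succ, List.foldl_append, ih fun j hj => hk j (by omega)]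
      simp only [List.foldl_cons, List.foldl_nil, memory]
      rw [dif_neg (hk k (by omega)), hist_succ]
  have hmove : ∀ k, (∀ j ≤ k, ¬ C'.Wired w (q' j)) → C'.E (q' k) (q' (k + 1)) ∧
      (q' k ∈ C'.VE → q' (k + 1) = R.move (hist q' k) (q' k)) := by
    intro k hk
    refine ⟨(hG'.edge_of_not_wired (hk k le_rfl)).1 (hp'.2 (t + k)).1, fun hx => ?_⟩
    have h1 := (hp'.2 (t + k)).2 (hG'.VE_eq ▸ hx)
    refine h1.trans ?_
    simp only [wireStrat]
    rw [dif_neg (hk k le_rfl)]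
    simp only [hstate k fun j hj => hk j hj.le]
    rfl
  have hp'E : ∀ n, G'.E (q' n) (q' (n + 1)) := fun n => (hp'.2 (t + n)).1
  by_cases hw : ∃ e, C'.Wired w (q' e)
  · have hmin := fun k => Nat.find_min hw (m := k)
    obtain hwe := Nat.find_spec hw
    set e := Nat.find hw
    obtain ⟨o, ho, hxo⟩ := hwe.choose_spec
    set i' := hwe.choose with hi'
    -- Domination speaks of infinite plays of `C'`, where the wired exit still has its self-loop.
    -- The finite segment becomes such a play by staying at the exit, where `R` has no other move.
    have hstay : C'.Play R (C'.entr i) (fun n => q' (min n e)) := by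
      refine ⟨by simpa [hq'] using ht, fun n => ?_⟩
      rcases lt_or_ge n e with hn | hn
      · simp only [min_eq_left hn.le, min_eq_left (show n + 1 ≤ e from hn)]
        rw [hist_congr (q := q') fun k hk => by rw [min_eq_left (by omega)]]
        exact hmove n fun j hj => hmin j (by omega)
      · simp only [min_eq_right hn, min_eq_right (Nat.le_succ_of_le hn), hxo]
        obtain ⟨y, hy⟩ := C'.exists_succ (C'.exi o)
        exact ⟨C'.exi_sink _ _ hy ▸ hy, fun _ => (C'.exi_sink _ _ (R.valid _ _)).symm⟩
    have hanswer : ∃ p, C.Play (localStrat C σ h) (C.entr i) p ∧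
        C.den p ≤ C'.den (stayPath (C'.entr i) (hist q' (e + 1))) := by
      rw [stayPath_hist]
      exact hRspec _ hstay
    obtain ⟨hpl, hle⟩ := hanswer.choose_spec
    -- The path chosen here is the one that `memory` appends to the simulated history.
    have hap : answer C C' σ h i (hist q' (e + 1)) = hanswer.choose := dif_pos hanswer
    set p := hanswer.choose
    rw [stayPath_hist, Arena.den_of_exit (fun n => (hstay.2 n).1) (e := e) (o := o)
      (by simpa using hxo)] at hle
    rcases Dom.eq_of_le_out hle with hd | ⟨m, hd, hm⟩
    -- A losing answer never exits, hence never meets a wire. It is a losing play of `G` too, below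
    -- whatever `p'` achieves.
    · left
      have hno := no_exit_of_den_eq_lose hd
      refine ⟨p, hG.play_of_not_wired hpl ?_, ?_⟩
      · rintro n ⟨i, o, -, hn⟩
        exact hno n o hn
      · rcases hG.den_of_no_exit hno with ⟨-, h2⟩ | ⟨h1, -⟩
        · rw [hd] at h2; cases h2
        · rw [h1]; exact Dom.lose_le' _
    · right
      obtain ⟨f, hf, hfmin, rfl⟩ := den_eq_out hd
      -- The segment has `f + 1` steps: `f` along `p` to the exit, then the wire. The segment of
      -- `p'` likewise has `e + 1` steps.
      let q : ℕ → V := fun n => if n ≤ f then p n else C.entr i'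
      have q_le : ∀ n, n ≤ f → q n = p n := fun n hn => if_pos hn
      have q_succ : q (f + 1) = C.entr i' := if_neg (by omega)
      have q_hist : ∀ n, n ≤ f + 1 → hist q n = hist p n := fun n hn =>
        hist_congr fun k hk => q_le k (by omega)
      have hpw : ∀ k < f, ¬ C.Wired w (p k) := by
        rintro k hk ⟨-, o', -, hk'⟩
        exact hfmin k hk o' hk'
      have hqf : q f = C.exi o := (q_le f le_rfl).trans hf
      have hq'e : q' (e + 1) = C'.entr i' := by
        have := hp'E e
        rw [hxo] at this
        exact (hG'.edge_exi ho).1 this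
      have hwq : ∀ i o, w o = some i → ∀ o', C.exi o ≠ G.exi o' := fun i o hio o' =>
        hG.exi_ne_of_wired ⟨i, o, hio, rfl⟩ o'
      refine ⟨q, f + 1, e + 1, i', ⟨Nat.succ_pos _, Nat.succ_pos _, ?_, ?_, ?_, ?_, ?_⟩,
        (q_le 0 (Nat.zero_le _)).trans hpl.1, q_succ, ?_, hq'e⟩
      · intro k hk
        rcases (Nat.le_of_lt_succ hk).lt_or_eq with hk | rfl
        · rw [q_le k hk.le, q_le (k + 1) hk]
          exact (hG.edge_of_not_wired (hpw k hk)).2 (hpl.2 k).1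
        · rw [hqf, q_succ]
          exact (hG.edge_exi ho).2 rfl
      · intro k hk hx
        rcases (Nat.le_of_lt_succ hk).lt_or_eq with hk | rfl
        · rw [q_le k hk.le] at hx ⊢
          rw [q_le (k + 1) hk, q_hist k (by omega), (hpl.2 k).2 (hG.VE_eq ▸ hx)]
          exact hG.localStrat_move σ h _ (hpw k hk)
        · rw [q_succ, hqf]
          exact ((hG.edge_exi ho).1 (σ.valid _ _)).symm
      · intro k hk o'
        rcases (Nat.le_of_lt_succ hk).lt_or_eq with hk | rfl
        · rw [q_le k hk.le, hG.exi_eq]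
          exact hfmin k hk _
        · rw [hqf]
          exact hwq _ _ ho o'
      · intro k hk o' hk'
        rcases (Nat.le_of_lt_succ hk).lt_or_eq with hk | rfl
        · have h1 := eq_exi_of_le hp'E hk' hk.le
          rw [hxo] at h1
          exact hG'.exi_ne_of_wired ⟨i', o, ho, rfl⟩ o' h1
        · exact hG'.exi_ne_of_wired hwe o' hk'
      -- Both segments end with a wire of priority `0`, so their maxima compare as those of the
      -- paths up to the exits.
      · rw [Finset.sup_congr rfl (fun k hk => ?_ : ∀ k ∈ Finset.range (f + 1),
            G.prio (q k) (q (k + 1)) = if k < f then C.prio (p k) (p (k + 1)) else 0),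
          Finset.sup_congr rfl (fun k hk => ?_ : ∀ k ∈ Finset.range (e + 1),
            G'.prio (p' (t + k)) (p' (t + (k + 1))) =
              if k < e then C'.prio (q' (min k e)) (q' (min (k + 1) e)) else 0)]
        · rw [Finset.range_add_one, Finset.sup_insert, if_neg (lt_irrefl _),
            Finset.range_add_one, Finset.sup_insert, if_neg (lt_irrefl _)]
          refine subKey_sup_le_sup le_rfl ?_
          rw [Finset.sup_congr rfl fun k hk => if_pos (Finset.mem_range.1 hk),
            Finset.sup_congr rfl fun k hk => if_pos (Finset.mem_range.1 hk)]
          exact hm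
        · rw [Finset.mem_range] at hk
          rw [hG'.prio_eq]
          rcases (Nat.le_of_lt_succ hk).lt_or_eq with hk | hk
          · rw [if_pos hk, min_eq_left hk.le, min_eq_left (show k + 1 ≤ e from hk)]
          · rw [if_neg (by omega), hk]
            change C'.prio (q' e) (q' (e + 1)) = 0
            rw [hq'e, hxo]
            exact hG'.prio_wire _ _ ho
        · rw [Finset.mem_range] at hk
          rcases (Nat.le_of_lt_succ hk).lt_or_eq with hk | rfl
          · rw [if_pos hk, q_le k hk.le, q_le (k + 1) hk, hG.prio_eq]
          · rw [if_neg (lt_irrefl _), q_succ, hqf, hG.prio_eq]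
            exact hG.prio_wire _ _ ho
      · rw [← add_assoc, hist_succ, List.foldl_append, hstate e hmin]
        simp only [List.foldl_cons, List.foldl_nil, memory]
        change (if hx : C'.Wired w (q' e) then _ else _) = _
        rw [dif_pos hwe]
        change (h ++ hist (answer C C' σ h i (hist q' e ++ [q' e])) (C.exitTime
          (answer C C' σ h i (hist q' e ++ [q' e])) + 1), i', ([] : List V')) = _
        rw [← hist_succ, hap, exitTime_eq hf hfmin, q_hist _ le_rfl]
  · push Not at hw
    left
    have hq'play : C'.Play R (C'.entr i) q' := ⟨ht, fun k => hmove k fun j _ => hw j⟩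
    obtain ⟨p, hpl, hle⟩ := hRspec q' hq'play
    -- Below `⊤` domination says nothing about `p`, which might use a wired exit; any play against
    -- `σ` serves instead.
    by_cases hwin : G'.den q' = .win
    · obtain ⟨p, hp⟩ := (σ.shift h).exists_play (C.entr i)
      exact ⟨p, hp, hwin ▸ Dom.le_win' _⟩
    cases hd' : C'.den q' with
    | win =>
      refine absurd ?_ hwin
      have hno : ∀ n o, q' n ≠ C'.exi o := fun n o hn => by
        rw [Arena.den_of_exit (fun n => (hq'play.2 n).1) hn] at hd'
        cases hd'
      rcases hG'.den_of_no_exit hno with ⟨h1, -⟩ | ⟨-, h2⟩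
      · exact h1
      · rw [hd'] at h2; cases h2
    | lose =>
      rw [hd'] at hle
      have hd := Dom.eq_lose_of_le hle
      have hno := no_exit_of_den_eq_lose hd
      refine ⟨p, hG.play_of_not_wired hpl ?_, ?_⟩
      · rintro n ⟨i, o, -, hn⟩
        exact hno n o hn
      · rcases hG.den_of_no_exit hno with ⟨-, h2⟩ | ⟨h1, -⟩
        · rw [hd] at h2; cases h2
        · rw [h1]; exact Dom.lose_le' _
    | out o m' =>
      rw [hd'] at hle
      rcases Dom.eq_of_le_out hle with hd | ⟨m, hd, hm⟩
      · have hno := no_exit_of_den_eq_lose hd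
        refine ⟨p, hG.play_of_not_wired hpl ?_, ?_⟩
        · rintro n ⟨i, o, -, hn⟩
          exact hno n o hn
        · rcases hG.den_of_no_exit hno with ⟨-, h2⟩ | ⟨h1, -⟩
          · rw [hd] at h2; cases h2
          · rw [h1]; exact Dom.lose_le' _
      · obtain ⟨e, he, -, -⟩ := den_eq_out hd'
        -- No wired exit is ever visited by `q'`, so `o` is still an exit after wiring. The answer
        -- `p` reaches only this exit, so it meets no wire either.
        rcases hG'.wired_or_exists o with hwo | ⟨o, rfl⟩
        · exact absurd (he ▸ hwo) (hw e)
        have hpw : ∀ n, ¬ C.Wired w (p n) := by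
          rintro n ⟨i', o', ho', hn⟩
          rw [Arena.den_of_exit (fun n => (hpl.2 n).1) hn] at hd
          injection hd with hd _
          rw [hd, hG.wire_eq_none] at ho'
          cases ho'
        have hpG := hG.play_of_not_wired hpl hpw
        refine ⟨p, hpG, ?_⟩
        rw [hG.den_of_exit (fun n => (hpG.2 n).1) hd, hG'.den_of_exit hp'E hd']
        exact Dom.out_le_out_iff.2 ⟨rfl, hm⟩

/-- Connecting exits to entrances preserves domination. -/
theorem Dominated.wiring (hG : IsWiring G C a b w) (hG' : IsWiring G' C' a b w)
    (H : ∀ i, Dominated C C' i i) (j : J) : Dominated G G' j j := by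
  intro σ
  refine ⟨wireStrat hG' H σ (a j), fun p' hp' => ?_⟩
  by_contra hcon
  have hE : ∀ n, G'.E (p' n) (p' (n + 1)) := fun n => (hp'.2 n).1
  -- Starts of segments from which no suitable play against `σ` exists. The failure assumed for
  -- contradiction provides the first one.
  let S := {s : List V × ℕ × I //
    ((hist p' s.2.1).foldl (memory C C' w σ) ([], a j, []) = (s.1, s.2.2, []) ∧
      p' s.2.1 = C'.entr s.2.2) ∧
    ¬ ∃ p, G.Play (σ.shift s.1) (C.entr s.2.2) p ∧ G.den p ≤ G'.den fun k => p' (s.2.1 + k)}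
  have hstep : ∀ s : S, ∃ s' : S, ∃ q N N', Matched G G' σ p' s.1.1 s.1.2.1 q N N' ∧
      q 0 = C.entr s.1.2.2 ∧ q N = C.entr s'.1.2.2 ∧ s'.1.1 = s.1.1 ++ hist q N ∧
      s'.1.2.1 = s.1.2.1 + N' := by
    rintro ⟨⟨h, t, i⟩, ⟨h1, h2⟩, h3⟩
    obtain ⟨q, N, N', i', hm, hq0, hqN, h4, h5⟩ :=
      (matched_or_exists_play hG hG' H hp' h1 h2).resolve_left h3
    -- A witness after the new segment would yield one before it, so the failure persists and the
    -- rounds never stop. Concatenating them all then produces the missing play.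
    refine ⟨⟨(h ++ hist q N, t + N', i'), ⟨h4, h5⟩, fun hp => h3 ?_⟩, q, N, N', hm, hq0, hqN, rfl,
      rfl⟩
    rw [← hqN] at hp
    rw [← hq0]
    exact hm.exists_play hE hp
  choose next q N N' hm hq0 hqN hh ht using hstep
  let s₀ : S := ⟨([], 0, a j), ⟨rfl, hp'.1.trans (hG'.entr_eq j)⟩, by
    simpa [hG.entr_eq] using hcon⟩
  let s : ℕ → S := fun n => n.rec s₀ fun _ => next
  refine hcon ?_
  have := exists_play_of_matched (σ := σ) (p' := p') (h := fun k => (s k).1.1)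
    (t := fun k => (s k).1.2.1) (q := fun k => q (s k)) (N := fun k => N (s k))
    (N' := fun k => N' (s k)) rfl rfl (fun k => hm (s k)) (fun k => hh (s k))
    (fun k => ht (s k)) fun k => (hqN (s k)).trans (hq0 (s (k + 1))).symm
  rwa [show q (s 0) 0 = G.entr j from (hq0 s₀).trans (hG.entr_eq j).symm] at this

end wiring

end Arena

/-! ### Renaming of exits -/

namespace Dom

variable {M : ℕ} {O P : Type}

/-- Renaming of exits. -/
def map (φ : O → P) : Dom M O → Dom M P
  | lose => lose
  | win => win
  | out o m => out (φ o) m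

theorem map_mono (φ : O → P) {d d' : Dom M O} (h : d ≤ d') : map φ d ≤ map φ d' := by
  cases h with
  | lose_le => exact .lose_le _
  | le_win => exact .le_win _
  | out_le_out o k k' hk => exact .out_le_out _ _ _ hk

end Dom

namespace Arena

/-! ### Components of an arena -/

/-- `A` is a component of `G`, closed under edges, via the map `f` of nodes and the map `φ` of
exits. -/
structure IsComponent {M : ℕ} {V W : Type*} {I O J P : Type} (A : Arena M V I O)
    (G : Arena M W J P) (f : V → W) (φ : O → P) : Prop where
  injective : Function.Injective f
  mem_VE_iff : ∀ x, f x ∈ G.VE ↔ x ∈ A.VE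
  edge_iff : ∀ x y, G.E (f x) y ↔ ∃ z, f z = y ∧ A.E x z
  prio_eq : ∀ x y, G.prio (f x) (f y) = A.prio x y
  eq_exi_iff : ∀ x q, f x = G.exi q ↔ ∃ o, φ o = q ∧ x = A.exi o

variable {M : ℕ} {V V' W W' : Type*} {I I' O J J' P : Type} {A : Arena M V I O}
  {A' : Arena M V' I' O} {G : Arena M W J P} {G' : Arena M W' J' P} {f : V → W} {f' : V' → W'}
  {φ : O → P}

theorem IsComponent.den_comp (h : IsComponent A G f φ) {p : ℕ → V}
    (hp : ∀ n, A.E (p n) (p (n + 1))) : G.den (fun n => f (p n)) = (A.den p).map φ := by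
  classical
  by_cases hex : ∃ e o, p e = A.exi o
  · obtain ⟨e, o, he⟩ := hex
    rw [den_of_exit hp he, den_of_exit (o := φ o) (e := e)
      (fun n => (h.edge_iff _ _).2 ⟨_, rfl, hp n⟩) ((h.eq_exi_iff _ _).2 ⟨o, rfl, he⟩)]
    exact congrArg _ (Finset.sup_congr rfl fun k _ => h.prio_eq _ _)
  · push Not at hex
    rw [den_of_no_exit hex, den_of_no_exit (C := G) fun n q hq => by
      obtain ⟨o, -, ho⟩ := (h.eq_exi_iff _ _).1 hq
      exact hex n o ho]
    rw [show (fun n => G.prio (f (p n)) (f (p (n + 1)))) = fun n => A.prio (p n) (p (n + 1)) from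
      funext fun n => h.prio_eq _ _]
    split_ifs <;> rfl

/-- A component is closed under edges, so a play that starts in it stays there. Hence `σ` need only
be read on histories in the image of `f`, and the dominating strategy is copied along `f'`, with
arbitrary moves elsewhere. -/
theorem Dominated.of_component (h : IsComponent A G f φ) (h' : IsComponent A' G' f' φ) {i : I}
    {i' : I'} (H : Dominated A A' i i') {j : J} {j' : J'} (hj : G.entr j = f (A.entr i))
    (hj' : G'.entr j' = f' (A'.entr i')) : Dominated G G' j j' := by
  classical
  intro σ
  have hσ : ∀ l x, ∃ z, f z = σ.move (List.map f l) (f x) ∧ A.E x z := fun l x =>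
    (h.edge_iff _ _).1 (σ.valid _ _)
  choose mv hmv hE using hσ
  obtain ⟨ρ, hρ⟩ := H ⟨mv, hE⟩
  have : Nonempty V' := ⟨A'.entr i'⟩
  let τ : G'.Strat :=
    { move := fun l y => if hy : ∃ x, f' x = y then
        f' (ρ.move (l.map (Function.invFun f')) hy.choose) else (G'.exists_succ y).choose
      valid := fun l y => by
        split_ifs with hy
        · have := (h'.edge_iff hy.choose _).2 ⟨_, rfl, ρ.valid (l.map (Function.invFun f')) _⟩
          rwa [hy.choose_spec] at this
        · exact (G'.exists_succ y).choose_spec }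
  have hτ : ∀ l x, τ.move (l.map f') (f' x) = f' (ρ.move l x) := fun l x => by
    have hx : ∃ z, f' z = f' x := ⟨x, rfl⟩
    have h1 : hx.choose = x := h'.injective hx.choose_spec
    have h2 : Function.invFun f' ∘ f' = id := Function.invFun_comp h'.injective
    simp only [τ]
    rw [dif_pos hx, List.map_map, h1, h2, List.map_id]
  refine ⟨τ, fun p' hp' => ?_⟩
  have hr : ∀ n, ∃ x, f' x = p' n := fun n => by
    induction n with
    | zero => exact ⟨_, (hp'.1.trans hj').symm⟩
    | succ n ih =>
      obtain ⟨x, hx⟩ := ih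
      have := (hp'.2 n).1
      rw [← hx, h'.edge_iff] at this
      exact this.imp fun _ hz => hz.1
  choose r hr using hr
  obtain rfl : (fun n => f' (r n)) = p' := funext hr
  have hplay : A'.Play ρ (A'.entr i') r := by
    refine ⟨h'.injective (hp'.1.trans hj'), fun n => ⟨?_, fun hx => ?_⟩⟩
    · obtain ⟨z, hz, hE⟩ := (h'.edge_iff _ _).1 (hp'.2 n).1
      rwa [← h'.injective hz]
    · have := (hp'.2 n).2 ((h'.mem_VE_iff _).2 hx)
      rw [hist_comp, hτ] at this
      exact h'.injective this
  obtain ⟨p, hp, hle⟩ := hρ r hplay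
  refine ⟨fun n => f (p n), ⟨?_, fun n => ⟨?_, fun hx => ?_⟩⟩, ?_⟩
  · exact (congrArg f hp.1).trans hj.symm
  · exact (h.edge_iff _ _).2 ⟨_, rfl, (hp.2 n).1⟩
  · rw [hist_comp]
    exact (congrArg f ((hp.2 n).2 ((h.mem_VE_iff _).1 hx))).trans (hmv _ _)
  · rw [h.den_comp fun n => (hp.2 n).1, h'.den_comp fun n => (hplay.2 n).1]
    exact Dom.map_mono φ hle

/-- The denotations of the plays that are consistent with `σ`. -/
def dens (A : Arena M V I O) (i : I) (σ : A.Strat) : Set (Dom M O) :=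
  {d | ∃ p, A.Play σ (A.entr i) p ∧ A.den p = d}

theorem Dominated.upperLe [Finite O] {i : I} {i' : I'} (H : Dominated A A' i i') (σ : A.Strat) :
    ∃ σ', Dom.UpperLe (Dom.worst (A.dens i σ)) (Dom.worst (A'.dens i' σ')) := by
  obtain ⟨σ', h⟩ := H σ
  refine ⟨σ', Dom.upperLe_worst_iff.2 ?_⟩
  rintro _ ⟨p', hp', rfl⟩
  obtain ⟨p, hp, hle⟩ := h p' hp'
  exact ⟨_, ⟨p, hp, rfl⟩, hle⟩

end Arena

namespace OPG

variable {M mr ml nr nl : ℕ}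

/-! ### From open parity games to arenas -/

/-- The arena of an open parity game. -/
def arena (A : OPG.{u} M mr ml nr nl) : Arena M A.V (Fin mr ⊕ Fin nl) (Fin nr ⊕ Fin ml) where
  VE := A.VE
  E := A.E
  prio := A.prio
  exists_succ := A.exists_succ
  entr := A.entr
  exi := A.exi
  exi_injective a b h := by simpa using @A.ends_injective (.inr a) (.inr b) h
  entr_ne_exi i o h := by simpa using @A.ends_injective (.inl i) (.inr o) h
  exi_sink := A.exi_sink
  exi_prio := A.exi_prio

theorem isChain_hist {V : Type*} {E : V → V → Prop} {p : ℕ → V} {n : ℕ}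
    (h : ∀ k < n, E (p k) (p (k + 1))) : List.IsChain E (hist p n ++ [p n]) := by
  induction n with
  | zero => simp
  | succ n ih =>
    have h1 := ih fun k hk => h k (by omega)
    rw [hist_succ, List.append_assoc]
    exact List.isChain_append_cons_cons.2 ⟨h1, h n (Nat.lt_succ_self n), by simp⟩

/-- Agreement on genuine paths suffices, as play histories are always paths. This also bridges the
two notions of strategy: `Strat` demands a legal move after every list of nodes. -/
theorem exists_play_iff (A : OPG.{u} M mr ml nr nl) {σ : A.EStrategy} {σ' : A.arena.Strat}
    (h : ∀ l (x : A.VE), List.IsChain A.E (l ++ [x.1]) → σ.move l x = σ'.move l x) (x : A.V)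
    (p : ℕ → A.V) : (∃ τ : A.AStrategy, A.play σ τ x = p) ↔ A.arena.Play σ' x p := by
  classical
  constructor
  · rintro ⟨τ, rfl⟩
    have hrun : ∀ n, (A.run σ τ x n).1 = hist (A.play σ τ x) n := fun n => by
      induction n with
      | zero => rfl
      | succ n ih => rw [hist_succ, ← ih]; rfl
    have hsucc : ∀ n, A.play σ τ x (n + 1) = if h : A.play σ τ x n ∈ A.VE then
        σ.move (hist (A.play σ τ x) n) ⟨_, h⟩ else τ.move (hist (A.play σ τ x) n) ⟨_, h⟩ :=
      fun n => by rw [← hrun]; rfl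
    have hE : ∀ n, A.E (A.play σ τ x n) (A.play σ τ x (n + 1)) := fun n => by
      induction n using Nat.strong_induction_on with
      | _ n ih =>
        have hc := isChain_hist ih
        rw [hsucc]
        split_ifs with hx
        · exact σ.valid _ ⟨_, hx⟩ hc
        · exact τ.valid _ ⟨_, hx⟩ hc
    refine ⟨rfl, fun n => ⟨hE n, fun hx => ?_⟩⟩
    rw [hsucc, dif_pos (show A.play σ τ x n ∈ A.VE from hx)]
    exact h _ ⟨_, hx⟩ (isChain_hist fun k _ => hE k)
  · intro hp
    -- To force the play `p`, `∀` only needs the length of the history to know which node comes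
    -- next.
    let τ : A.AStrategy :=
      { move := fun l y => if A.E y (p (l.length + 1)) then p (l.length + 1) else
          (A.exists_succ y).choose
        valid := fun l y _ => by
          split_ifs with hy
          · exact hy
          · exact (A.exists_succ y).choose_spec }
    have hrun : ∀ n, A.run σ τ x n = (hist p n, p n) := fun n => by
      induction n with
      | zero => exact Prod.ext rfl hp.1.symm
      | succ n ih =>
        have hE := (hp.2 n).1
        rw [run, ih, hist_succ]
        refine Prod.ext rfl ?_
        simp only
        split_ifs with hx
        · rw [h _ ⟨_, hx⟩ (isChain_hist fun k _ => (hp.2 k).1)]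
          exact ((hp.2 n).2 hx).symm
        · simp only [τ, length_hist]
          exact if_pos hE
    exact ⟨τ, funext fun n => congrArg Prod.snd (hrun n)⟩

theorem den_arena (A : OPG.{u} M mr ml nr nl) (p : ℕ → A.V) : A.arena.den p = A.den p := by
  unfold den Arena.den
  congr!

theorem outcome_eq (A : OPG.{u} M mr ml nr nl) {σ : A.EStrategy} {σ' : A.arena.Strat}
    (h : ∀ l (x : A.VE), List.IsChain A.E (l ++ [x.1]) → σ.move l x = σ'.move l x)
    (i : Fin mr ⊕ Fin nl) : A.outcome i σ = Dom.worst (A.arena.dens i σ') := by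
  unfold outcome
  congr 1
  ext d
  constructor
  · rintro ⟨τ, rfl⟩
    exact ⟨_, (A.exists_play_iff h _ _).1 ⟨τ, rfl⟩, A.den_arena _⟩
  · rintro ⟨p, hp, rfl⟩
    obtain ⟨τ, rfl⟩ := (A.exists_play_iff h _ _).2 hp
    exact ⟨τ, (A.den_arena _).symm⟩

theorem exists_outcome_eq_iff (A : OPG.{u} M mr ml nr nl) (i : Fin mr ⊕ Fin nl)
    (T : Set (Dom M (Fin nr ⊕ Fin ml))) :
    (∃ σ : A.EStrategy, A.outcome i σ = T) ↔
      ∃ σ : A.arena.Strat, Dom.worst (A.arena.dens i σ) = T := by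
  classical
  constructor
  · rintro ⟨σ, rfl⟩
    let σ' : A.arena.Strat :=
      { move := fun l x => if h : x ∈ A.VE ∧ List.IsChain A.E (l ++ [x]) then σ.move l ⟨x, h.1⟩ else
          (A.exists_succ x).choose
        valid := fun l x => by
          split_ifs with h
          · exact σ.valid l ⟨x, h.1⟩ h.2
          · exact (A.exists_succ x).choose_spec }
    have h : ∀ l (x : A.VE), List.IsChain A.E (l ++ [x.1]) → σ.move l x = σ'.move l x :=
      fun l x hx => by simp [σ', hx]
    exact ⟨σ', (A.outcome_eq h i).symm⟩
  · rintro ⟨σ, rfl⟩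
    let σ' : A.EStrategy := ⟨fun l x => σ.move l x, fun l x _ => σ.valid l x⟩
    exact ⟨σ', A.outcome_eq (fun _ _ _ => rfl) i⟩

theorem paretoFront_eq (A : OPG.{u} M mr ml nr nl) (i : Fin mr ⊕ Fin nl) :
    A.paretoFront i = Dom.best {T | ∃ σ, Dom.worst (A.arena.dens i σ) = T} := by
  unfold paretoFront
  congr 1
  ext T
  exact A.exists_outcome_eq_iff i T

theorem paretoFront_eq_of_dominated {A : OPG.{u} M mr ml nr nl} {B : OPG.{v} M mr ml nr nl}
    {i : Fin mr ⊕ Fin nl} (hAB : Arena.Dominated A.arena B.arena i i)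
    (hBA : Arena.Dominated B.arena A.arena i i) : A.paretoFront i = B.paretoFront i := by
  rw [paretoFront_eq, paretoFront_eq]
  exact (Dom.best_subset hAB.upperLe hBA.upperLe).antisymm (Dom.best_subset hBA.upperLe hAB.upperLe)

/-! ### The shortcut has the same Pareto fronts -/

section shortcut

variable (A : OPG.{u} M mr ml nr nl) {i : Fin mr ⊕ Fin nl}

theorem eq_of_mem_paretoFront_of_le {r : Set (Dom M (Fin nr ⊕ Fin ml))} (hr : r ∈ A.paretoFront i)
    {d e : Dom M (Fin nr ⊕ Fin ml)} (hd : d ∈ r) (he : e ∈ r) (h : d ≤ e) : d = e := by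
  obtain ⟨⟨σ, rfl⟩, -⟩ := hr
  exact le_antisymm h (he.2 hd.1 h)

/-- The arena of the shortcut. -/
noncomputable def shortcutArena : Arena M A.ShortcutNode (Fin mr ⊕ Fin nl) (Fin nr ⊕ Fin ml) :=
  A.shortcut.arena

/-- A result is an antichain, so if it contains `⊤` or `⊥` it contains nothing else, and its node
has no edge to an exit. -/
theorem shortcut_stay (r : A.paretoFront i) (hr : Dom.win ∈ r.1 ∨ Dom.lose ∈ r.1)
    {y : A.ShortcutNode} (hy : A.shortcutE (.inr ⟨i, r⟩) y) : y = .inr ⟨i, r⟩ := by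
  rcases y with ((i' | o) | y)
  · exact hy.elim
  · obtain ⟨m, hm⟩ := hy
    rcases hr with h | h
    · cases A.eq_of_mem_paretoFront_of_le r.2 hm h (Dom.le_win' _)
    · cases A.eq_of_mem_paretoFront_of_le r.2 h hm (Dom.lose_le' _)
  · exact congrArg Sum.inr hy.1

theorem den_shortcut_mem (hM : M ≠ 0) (r : A.paretoFront i) {p : ℕ → A.ShortcutNode}
    (hp : ∀ n, A.shortcutE (p n) (p (n + 1))) (h0 : p 0 = .inl (.inl i))
    (h1 : p 1 = .inr ⟨i, r⟩) : A.shortcutArena.den p ∈ r.1 := by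
  classical
  by_cases hr : Dom.win ∈ r.1 ∨ Dom.lose ∈ r.1
  · have hstay : ∀ n, p (1 + n) = .inr ⟨i, r⟩ := fun n => by
      induction n with
      | zero => exact h1
      | succ n ih =>
        have := hp (1 + n)
        rw [ih] at this
        exact A.shortcut_stay r hr this
    have hno : ∀ n o, p n ≠ A.shortcutArena.exi o := fun n o hn => by
      rcases n with - | n
      · rw [h0] at hn; cases hn
      · rw [add_comm, hstay] at hn; cases hn
    rw [Arena.den_of_no_exit hno, ← limEven_shift _ 1]
    have : ∀ n, A.shortcutArena.prio (p (1 + n)) (p (1 + n + 1)) =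
        if Dom.lose ∈ r.1 then 1 else 0 := fun n => by
      rw [hstay, add_assoc, hstay]; rfl
    simp only [this, limEven_const]
    by_cases hl : Dom.lose ∈ r.1
    -- For `M = 0` the numeral `1` of `Fin (M + 1)` would be `0`, and the losing self-loop would be
    -- winning.
    · obtain ⟨k, rfl⟩ := Nat.exists_eq_succ_of_ne_zero hM
      simp [hl]
    · simpa [hl] using hr
  · have h2 := hp 1
    rw [h1] at h2
    rcases h : p 2 with ((i' | o) | y)
    · rw [h] at h2; exact h2.elim
    · rw [h] at h2
      obtain ⟨m, hm⟩ := h2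
      rw [Arena.den_of_exit (C := A.shortcutArena) hp (e := 2) (o := o) h]
      have h3 : A.shortcutArena.prio (p 0) (p 1) = 0 := by rw [h0, h1]; rfl
      have h4 : A.shortcutArena.prio (p 1) (p 2) = m := by
        rw [h1, h]; exact A.shortcutPrio_eq ⟨i, r⟩ o m hm
      have h5 : m ⊔ 0 = m := sup_eq_left.2 (Fin.zero_le _)
      simpa [Finset.range_add_one, h3, h4, h5] using hm
    · rw [h] at h2
      exact absurd h2.2 hr

/-- In the shortcut `∃` picks a result `r` of the Pareto front above the outcome of `σ`. Every play
then ends with a denotation in `r`. -/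
theorem dominated_shortcut (hM : M ≠ 0) :
    Arena.Dominated A.arena A.shortcutArena i i := by
  classical
  intro σ
  obtain ⟨r, hr, hle⟩ := Dom.exists_best_ge (S := {T | ∃ σ, Dom.worst (A.arena.dens i σ) = T})
    ⟨σ, rfl⟩
  rw [← paretoFront_eq] at hr
  let σ' : A.shortcutArena.Strat :=
    { move := fun _ x => if x = A.shortcutArena.entr i then .inr ⟨i, r, hr⟩ else
        (A.shortcutArena.exists_succ x).choose
      valid := fun _ x => by
        split_ifs with h
        · rw [h]; exact rfl
        · exact (A.shortcutArena.exists_succ x).choose_spec }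
  refine ⟨σ', fun p' hp' => ?_⟩
  have h1 : p' 1 = .inr ⟨i, r, hr⟩ := by
    rw [(hp'.2 0).2 (by rw [hp'.1]; exact A.shortcut.entr_mem i), hp'.1]
    exact if_pos rfl
  obtain ⟨d, ⟨⟨p, hp, rfl⟩, -⟩, hd⟩ :=
    hle _ (A.den_shortcut_mem hM ⟨r, hr⟩ (fun n => (hp'.2 n).1) hp'.1 h1)
  exact ⟨p, hp, hd⟩

theorem exists_shortcut_play (hM : M ≠ 0) {σ : A.shortcutArena.Strat} (r : A.paretoFront i)
    (hσ : σ.move [] (A.shortcutArena.entr i) = .inr ⟨i, r⟩) {d : Dom M (Fin nr ⊕ Fin ml)}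
    (hd : d ∈ r.1) : ∃ p, A.shortcutArena.Play σ (A.shortcutArena.entr i) p ∧
      A.shortcutArena.den p = d := by
  -- `y` is the move by which `∀` realises `d`: the exit itself, or the self-loop if `d` is `⊤` or
  -- `⊥`. In both cases the play stays at `y` from then on.
  obtain ⟨y, hy, hy', hdy⟩ : ∃ y : A.ShortcutNode, A.shortcutE (.inr ⟨i, r⟩) y ∧
      (∀ z, A.shortcutE y z ↔ z = y) ∧
      ∀ p : ℕ → A.ShortcutNode, (∀ n, A.shortcutE (p n) (p (n + 1))) → p 0 = .inl (.inl i) →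
        p 1 = .inr ⟨i, r⟩ → p 2 = y → A.shortcutArena.den p = d := by
    have key : (Dom.win ∈ r.1 ∨ Dom.lose ∈ r.1) → ∃ y : A.ShortcutNode,
        A.shortcutE (.inr ⟨i, r⟩) y ∧ (∀ z, A.shortcutE y z ↔ z = y) ∧
        ∀ p : ℕ → A.ShortcutNode, (∀ n, A.shortcutE (p n) (p (n + 1))) → p 0 = .inl (.inl i) →
          p 1 = .inr ⟨i, r⟩ → p 2 = y → A.shortcutArena.den p = d := fun hr => by
      have hE : A.shortcutE (.inr ⟨i, r⟩) (.inr ⟨i, r⟩) := ⟨rfl, hr⟩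
      refine ⟨.inr ⟨i, r⟩, hE, fun z => ⟨A.shortcut_stay r hr, fun hz => hz ▸ hE⟩,
        fun p hp h0 h1 _ => ?_⟩
      have hmem := A.den_shortcut_mem hM r hp h0 h1
      rcases hr with hr | hr
      · rw [A.eq_of_mem_paretoFront_of_le r.2 hmem hr (Dom.le_win' _),
          A.eq_of_mem_paretoFront_of_le r.2 hd hr (Dom.le_win' _)]
      · rw [← A.eq_of_mem_paretoFront_of_le r.2 hr hmem (Dom.lose_le' _),
          A.eq_of_mem_paretoFront_of_le r.2 hr hd (Dom.lose_le' _)]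
    cases d with
    | win => exact key (.inl hd)
    | lose => exact key (.inr hd)
    | out o m =>
      refine ⟨.inl (.inr o), ⟨m, hd⟩, fun z => ?_, fun p hp h0 h1 h2 => ?_⟩
      · constructor
        · exact A.shortcutArena.exi_sink o z
        · rintro rfl
          exact rfl
      · have hmem := A.den_shortcut_mem hM r hp h0 h1
        rw [Arena.den_of_exit (C := A.shortcutArena) hp (e := 2) (o := o) h2] at hmem ⊢
        rw [A.out_unique r.2 hmem hd]
  let p : ℕ → A.ShortcutNode := fun n => match n with
    | 0 => .inl (.inl i)
    | 1 => .inr ⟨i, r⟩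
    | _ + 2 => y
  have hp : ∀ n, A.shortcutE (p n) (p (n + 1)) := fun n => match n with
    | 0 => rfl
    | 1 => hy
    | _ + 2 => (hy' y).2 rfl
  refine ⟨p, ⟨rfl, fun n => ⟨hp n, fun hx => ?_⟩⟩, hdy p hp rfl rfl rfl⟩
  match n with
  | 0 => exact hσ.symm
  | 1 =>
    obtain ⟨z, hz⟩ := hx
    cases hz
  | n + 2 => exact ((hy' _).1 (σ.valid _ y)).symm

/-- The first move of `σ` picks a result `r`, which is the outcome of some strategy of `A`. Each
play against that strategy lies above an element of `r`, and `∀` can realise that element in the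
shortcut. -/
theorem shortcut_dominated (hM : M ≠ 0) :
    Arena.Dominated A.shortcutArena A.arena i i := by
  intro σ
  obtain ⟨r, hr⟩ : ∃ r : A.paretoFront i, σ.move [] (A.shortcutArena.entr i) = .inr ⟨i, r⟩ := by
    have h := σ.valid [] (A.shortcutArena.entr i)
    rcases hy : σ.move [] (A.shortcutArena.entr i) with ((i' | o) | ⟨i', r⟩)
    · rw [hy] at h; exact h.elim
    · rw [hy] at h; exact h.elim
    · rw [hy] at h
      cases (show i' = i from h)
      exact ⟨r, rfl⟩
  obtain ⟨σ', hσ'⟩ := (A.exists_outcome_eq_iff i _).1 r.2.1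
  refine ⟨σ', fun p' hp' => ?_⟩
  obtain ⟨d, hd, hle⟩ := Dom.upperLe_worst (A.arena.dens i σ') _ ⟨p', hp', rfl⟩
  rw [hσ'] at hd
  obtain ⟨p, hp, rfl⟩ := A.exists_shortcut_play hM r hr hd
  exact ⟨p, hp, hle⟩

end shortcut

/-! ### Sums -/

section sum

universe u' v'

variable {kr kl lr ll : ℕ}

theorem isComponent_sum_left (A : OPG.{u} M mr ml nr nl) (B : OPG.{v} M kr kl lr ll) :
    Arena.IsComponent A.arena (A.sum B).arena Sum.inl
      (Sum.map (Fin.castAdd lr) (Fin.castAdd kl)) where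
  injective := Sum.inl_injective
  mem_VE_iff _ := Iff.rfl
  edge_iff x y := by
    rcases y with y | y <;> simp [arena, sum]
  prio_eq _ _ := rfl
  eq_exi_iff x q := by
    rcases q with q | q <;> induction q using Fin.addCases <;> simp [arena, sum, Fin.ext_iff]
    all_goals first
      | (intro a ha; omega)
      | simp [← Fin.ext_iff]

theorem isComponent_sum_right (A : OPG.{u} M mr ml nr nl) (B : OPG.{v} M kr kl lr ll) :
    Arena.IsComponent B.arena (A.sum B).arena Sum.inr
      (Sum.map (Fin.natAdd nr) (Fin.natAdd ml)) where
  injective := Sum.inr_injective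
  mem_VE_iff _ := Iff.rfl
  edge_iff x y := by
    rcases y with y | y <;> simp [arena, sum]
  prio_eq _ _ := rfl
  eq_exi_iff x q := by
    rcases q with q | q <;> induction q using Fin.addCases <;> simp [arena, sum, Fin.ext_iff]
    all_goals first
      | (intro a ha; omega)
      | simp [← Fin.ext_iff]

theorem dominated_sum {A : OPG.{u} M mr ml nr nl} {B : OPG.{v} M kr kl lr ll}
    {A' : OPG.{u'} M mr ml nr nl} {B' : OPG.{v'} M kr kl lr ll}
    (hA : ∀ i, Arena.Dominated A.arena A'.arena i i)
    (hB : ∀ i, Arena.Dominated B.arena B'.arena i i) (i : Fin (mr + kr) ⊕ Fin (nl + ll)) :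
    Arena.Dominated (A.sum B).arena (A'.sum B').arena i i := by
  have hl := fun (j : Fin mr ⊕ Fin nl) (h) (h') => Arena.Dominated.of_component (j := i) (j' := i)
    (isComponent_sum_left A B) (isComponent_sum_left A' B') (hA j) h h'
  have hr := fun (j : Fin kr ⊕ Fin ll) (h) (h') => Arena.Dominated.of_component (j := i) (j' := i)
    (isComponent_sum_right A B) (isComponent_sum_right A' B') (hB j) h h'
  rcases i with k | k <;> induction k using Fin.addCases with
  | left k => first
    | exact hl (.inl k) (by simp [arena, sum]) (by simp [arena, sum])
    | exact hl (.inr k) (by simp [arena, sum]) (by simp [arena, sum])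
  | right k => first
    | exact hr (.inl k) (by simp [arena, sum]) (by simp [arena, sum])
    | exact hr (.inr k) (by simp [arena, sum]) (by simp [arena, sum])

end sum

/-! ### Sequential composition -/

section seq

universe u' v'

variable {lr ll : ℕ}

/-- The connections that turn the sum into the sequential composition. -/
def seqWire (mr ml lr ll nr nl : ℕ) :
    Fin (lr + nr) ⊕ Fin (ml + ll) → Option (Fin (mr + lr) ⊕ Fin (ll + nl))
  | .inl k => Fin.addCases (fun k => some (.inl (Fin.natAdd mr k))) (fun _ => none) k
  | .inr k => Fin.addCases (fun _ => none) (fun k => some (.inr (Fin.castAdd nl k))) k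

theorem seqWire_eq_some_iff {o : Fin (lr + nr) ⊕ Fin (ml + ll)}
    {i : Fin (mr + lr) ⊕ Fin (ll + nl)} : seqWire mr ml lr ll nr nl o = some i ↔
      (∃ k, o = .inl (Fin.castAdd nr k) ∧ i = .inl (Fin.natAdd mr k)) ∨
        ∃ k, o = .inr (Fin.natAdd ml k) ∧ i = .inr (Fin.castAdd nl k) := by
  constructor
  · rcases o with k | k <;> induction k using Fin.addCases with
    | left k => simp [seqWire, eq_comm]
    | right k => simp [seqWire, eq_comm]
  · rintro (⟨k, rfl, rfl⟩ | ⟨k, rfl, rfl⟩) <;> simp [seqWire]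

/-- In the sum, the ends of `A` precede those of `B`. So the wires run from the first `lr` rightward
exits to the last `lr` rightward entrances, and from the last `ll` leftward exits to the first `ll`
leftward entrances. -/
theorem isWiring_seq (A : OPG.{u} M mr ml lr ll) (B : OPG.{v} M lr ll nr nl) :
    Arena.IsWiring (A.seq B).arena (A.sum B).arena
      (Sum.map (Fin.castAdd lr) (Fin.natAdd ll)) (Sum.map (Fin.natAdd lr) (Fin.castAdd ll))
      (seqWire mr ml lr ll nr nl) where
  VE_eq := rfl
  edge_iff x y := by
    have h1 : (∃ i o, seqWire mr ml lr ll nr nl o = some i ∧ x = (A.sum B).arena.exi o ∧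
        y = (A.sum B).arena.entr i) ↔
        (∃ k, x = .inl (A.exi (.inl k)) ∧ y = .inr (B.entr (.inl k))) ∨
          ∃ k, x = .inr (B.exi (.inr k)) ∧ y = .inl (A.entr (.inr k)) := by
      constructor
      · rintro ⟨i, o, h, rfl, rfl⟩
        rcases seqWire_eq_some_iff.1 h with ⟨k, rfl, rfl⟩ | ⟨k, rfl, rfl⟩
        · exact .inl ⟨k, by simp [arena, sum]; exact ⟨rfl, rfl⟩⟩
        · exact .inr ⟨k, by simp [arena, sum]; exact ⟨rfl, rfl⟩⟩
      · rintro (⟨k, rfl, rfl⟩ | ⟨k, rfl, rfl⟩)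
        · exact ⟨_, _, seqWire_eq_some_iff.2 (.inl ⟨k, rfl, rfl⟩), by simp [arena, sum]; exact ⟨rfl, rfl⟩⟩
        · exact ⟨_, _, seqWire_eq_some_iff.2 (.inr ⟨k, rfl, rfl⟩), by simp [arena, sum]; exact ⟨rfl, rfl⟩⟩
    have h2 : (∀ i o, seqWire mr ml lr ll nr nl o = some i → x ≠ (A.sum B).arena.exi o) ↔
        (∀ k, x ≠ .inl (A.exi (.inl k))) ∧ ∀ k, x ≠ .inr (B.exi (.inr k)) := by
      constructor
      · intro h
        refine ⟨fun k => ?_, fun k => ?_⟩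
        · simpa [arena, sum] using h _ _ (seqWire_eq_some_iff.2 (.inl ⟨k, rfl, rfl⟩))
        · simpa [arena, sum] using h _ _ (seqWire_eq_some_iff.2 (.inr ⟨k, rfl, rfl⟩))
      · intro h i o ho
        rcases seqWire_eq_some_iff.1 ho with ⟨k, rfl, rfl⟩ | ⟨k, rfl, rfl⟩
        · simpa [arena, sum] using h.1 k
        · simpa [arena, sum] using h.2 k
    rw [h1, h2]
    rcases x with x | x <;> rcases y with y | y <;> simp [arena, sum, seq, seqE]
  prio_eq x y := by
    rcases x with x | x <;> rcases y with y | y <;> rfl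
  prio_wire i o h := by
    rcases seqWire_eq_some_iff.1 h with ⟨k, rfl, rfl⟩ | ⟨k, rfl, rfl⟩ <;> simp [arena, sum]
  entr_eq := by
    rintro (k | k) <;> simp [arena, seq, sum]
  exi_eq := by
    rintro (k | k) <;> simp [arena, seq, sum]
  wire_eq_none := by
    rintro (k | k) <;> simp [seqWire]
  exists_eq := by
    rintro (k | k) <;> induction k using Fin.addCases <;> simp [seqWire]

theorem dominated_seq {A : OPG.{u} M mr ml lr ll} {B : OPG.{v} M lr ll nr nl}
    {A' : OPG.{u'} M mr ml lr ll} {B' : OPG.{v'} M lr ll nr nl}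
    (hA : ∀ i, Arena.Dominated A.arena A'.arena i i)
    (hB : ∀ i, Arena.Dominated B.arena B'.arena i i) (i : Fin mr ⊕ Fin nl) :
    Arena.Dominated (A.seq B).arena (A'.seq B').arena i i :=
  .wiring (isWiring_seq A B) (isWiring_seq A' B') (dominated_sum hA hB) i

end seq

end OPG

/-! ### The proposition for both compositions -/

theorem mainTheorem3 (M : ℕ) (hM : Even M) (hM2 : 2 ≤ M) :
    (∀ (mr ml lr ll nr nl : ℕ) (A : OPG.{u} M mr ml lr ll) (B : OPG.{v} M lr ll nr nl)
      (i : Fin mr ⊕ Fin nl),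
      (A.seq B).paretoFront i = (A.shortcut.seq B.shortcut).paretoFront i) ∧
    (∀ (mr ml nr nl kr kl lr ll : ℕ) (A : OPG.{u} M mr ml nr nl) (B : OPG.{v} M kr kl lr ll)
      (i : Fin (mr + kr) ⊕ Fin (nl + ll)),
      (A.sum B).paretoFront i = (A.shortcut.sum B.shortcut).paretoFront i) := by
  have hM0 : M ≠ 0 := by omega
  constructor
  · intro mr ml lr ll nr nl A B i
    exact OPG.paretoFront_eq_of_dominated
      (OPG.dominated_seq (fun _ => A.dominated_shortcut hM0) (fun _ => B.dominated_shortcut hM0) i)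
      (OPG.dominated_seq (fun _ => A.shortcut_dominated hM0) (fun _ => B.shortcut_dominated hM0) i)
  · intro mr ml nr nl kr kl lr ll A B i
    exact OPG.paretoFront_eq_of_dominated
      (OPG.dominated_sum (fun _ => A.dominated_shortcut hM0) (fun _ => B.dominated_shortcut hM0) i)
      (OPG.dominated_sum (fun _ => A.shortcut_dominated hM0) (fun _ => B.shortcut_dominated hM0) i)
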